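/- Let $A\subseteq\mathbb R^d$ be a nonempty closed convex set, $Y$ a real Banach space, $K\subset Y$ a nonempty closed convex cone, and $W$ a nonempty compact Hausdorff space. Let $f\colon\mathbb R^d\times W\to\mathbb R$ and $G\colon\mathbb R^d\to Y$, put $F(x)=\max_{\omega\in W}f(x,\omega)$, $\Omega=\{x\in A: G(x)\in K\}$, and consider the problem $$(\mathcal P)\qquad \min F(x)\quad\text{subject to } x\in\Omega .$$ Let $x_*\in\Omega$, and suppose that on some open neighbourhood $\mathcal O$ of $x_*$ the function $f(x,\omega)$ is differentiable in $x$, $f$ and $\nabla_x f$ are jointly continuous on $\mathcal O\times W$, and $G$ is continuously Fréchet differentiable. Notation. $|\cdot|$ is the Euclidean norm. $T_C(x)$ is the contingent cone to $C$ at $x$: all $h$ for which there are $\alpha_n>0$, $\alpha_n\to0$, and $h_n\to h$ with $x+\alpha_nh_n\in C$ for all $n$. $N_A(x)=\{z:\langle z,v\rangle\le0\ \forall v\in T_A(x)\}$. $W(x_*)=\{\omega\in W: f(x_*,\omega)=F(x_*)\}$. $K^*=\{\lambda\in Y^*:\langle\lambda,y\rangle\le 0\ \forall y\in K\}$. $\operatorname{dist}(y,K)=\inf_{z\in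 K}\|y-z\|$ and $\Phi_c(x)=F(x)+c\operatorname{dist}(G(x),K)$ for $c\ge0$. $\partial\Phi_c(x_*)$ is the Hadamard subdifferential: the unique convex compact set such that for every $h\in\mathbb R^d$ the limit $\lim_{[\alpha,h']\to[+0,h]}\big(\Phi_c(x_*+\alpha h')-\Phi_c(x_*)\big)/\alpha$ exists and equals $\max_{v\in\partial\Phi_c(x_*)}\langle v,h\rangle$. * A Lagrange multiplier at $x_*$ is a $\lambda\in K^*$ with $\langle\lambda,G(x_*)\rangle=0$ such that the directional derivative of $F(\cdot)+\langle\lambda,G(\cdot)\rangle$ at $x_*$ in every direction $h\in T_A(x_*)$ exists and is nonnegative. * (SuffOptCond) is the condition: $\max_{\omega\in W(x_*)}\langle\nabla_xf(x_*,\omega),h\rangle>0$ for all $h\in T_A(x_*)\setminus\{0\}$ with $DG(x_*)h\in T_K(G(x_*))$. * RCQ holds at $x_*$ if $0\in\operatorname{int}\{G(x_*)+DG(x_*)(A-x_*)-K\}$. * A function $\varphi$ satisfies the first order growth condition on a set $S\ni x_*$ at $x_*$ if there are $\rho>0$ and a neighbourhood $\mathcal U$ of $x_*$ with $\varphi(x)\ge\varphi(x_*)+\rho|x-x_*|$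 for all $x\in\mathcal U\cap S$. The first order growth condition for $(\mathcal P)$ at $x_*$ is that of $F$ on $\Omega$. * $\Phi_c$ is locally exact at $x_*$ if there is $c_*\ge0$ such that for every $c\ge c_*$ the point $x_*$ is a local minimizer of $\Phi_c$ on $A$. Then: 1. A Lagrange multiplier of $(\mathcal P)$ at $x_*$ exists if and only if there is $c\ge0$ with $0\in\partial\Phi_c(x_*)+N_A(x_*)$. 2. (SuffOptCond) holds at $x_*$ if and only if there is $c\ge0$ with $0\in\operatorname{int}\big(\partial\Phi_c(x_*)+N_A(x_*)\big)$, and if and only if there is $c\ge0$ such that $\Phi_c$ satisfies the first order growth condition on $A$ at $x_*$. 3. Suppose RCQ holds at $x_*$. If $x_*$ is a locally optimal solution of $(\mathcal P)$, then $\Phi_c$ is locally exact at $x_*$. Moreover (without assuming local optimality), the first order growth condition for $(\mathcal P)$ holds at $x_*$ if and only if there is $c\ge0$ such that $\Phi_c$ satisfies the first order growth condition on $A$ at $x_*$. -/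

import Mathlib

open Filter Topology Set
open scoped Pointwise

namespace ConeMinimax

noncomputable section

section Cones

/-- The contingent (Bouligand tangent) cone to `C` at `x`. -/
def contingentCone {X : Type*} [NormedAddCommGroup X] [NormedSpace ℝ X] (C : Set X) (x : X) :
    Set X :=
  {h | ∃ (α : ℕ → ℝ) (u : ℕ → X), (∀ n, 0 < α n) ∧ Tendsto α atTop (𝓝 0) ∧
    Tendsto u atTop (𝓝 h) ∧ ∀ n, x + α n • u n ∈ C}

/-- The normal cone to `A` at `x`: the polar of the contingent cone. -/
def normalCone {E : Type*} [NormedAddCommGroup E] [InnerProductSpace ℝ E] (A : Set E) (x : E) :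
    Set E :=
  {z | ∀ v ∈ contingentCone A x, inner ℝ z v ≤ 0}

/-- The polar cone `K^* = {y^* | ⟨y^*, y⟩ ≤ 0 for all y ∈ K}` in the topological dual. -/
def polarCone {Y : Type*} [NormedAddCommGroup Y] [NormedSpace ℝ Y] (K : Set Y) :
    Set (StrongDual ℝ Y) :=
  {l | ∀ y ∈ K, l y ≤ 0}

end Cones

section Derivatives

/-- `d` is the (one-sided) directional derivative of `φ` at `x` in the direction `h`. -/
def HasDirDeriv {E : Type*} [NormedAddCommGroup E] [NormedSpace ℝ E]
    (φ : E → ℝ) (x h : E) (d : ℝ) : Prop :=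
  Tendsto (fun t : ℝ => (φ (x + t • h) - φ x) / t) (𝓝[>] 0) (𝓝 d)

/-- `d` is the Hadamard directional derivative of `φ` at `x` in the direction `h`: the limit of
`(φ (x + α h') - φ x) / α` as `[α, h'] → [+0, h]`. -/
def HasHadamardDirDeriv {E : Type*} [NormedAddCommGroup E] [NormedSpace ℝ E]
    (φ : E → ℝ) (x h : E) (d : ℝ) : Prop :=
  Tendsto (fun p : ℝ × E => (φ (x + p.1 • p.2) - φ x) / p.1) (𝓝[>] 0 ×ˢ 𝓝 h) (𝓝 d)

/-- `S` is a Hadamard subdifferential of `φ` at `x`: it is convex and compact, and for every `h`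
the Hadamard directional derivative `φ'(x, h)` exists and equals `max_{v ∈ S} ⟨v, h⟩`. -/
structure IsHadamardSubdifferential {E : Type*} [NormedAddCommGroup E] [InnerProductSpace ℝ E]
    (φ : E → ℝ) (x : E) (S : Set E) : Prop where
  convex : Convex ℝ S
  isCompact : IsCompact S
  dirDeriv : ∀ h : E, ∃ m : ℝ, IsGreatest ((fun v : E => inner ℝ v h) '' S) m ∧
    HasHadamardDirDeriv φ x h m

/-- The Hadamard subdifferential `∂φ(x)`: the unique set `S` with
`IsHadamardSubdifferential φ x S` (see `hadamardSubdifferential_eq`); it is empty if `φ` is not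
Hadamard subdifferentiable at `x`. -/
def hadamardSubdifferential {E : Type*} [NormedAddCommGroup E] [InnerProductSpace ℝ E]
    (φ : E → ℝ) (x : E) : Set E :=
  ⋃₀ {S | IsHadamardSubdifferential φ x S}

theorem IsHadamardSubdifferential.subset {E : Type*} [NormedAddCommGroup E]
    [InnerProductSpace ℝ E] [CompleteSpace E] {φ : E → ℝ} {x : E} {S T : Set E}
    (hS : IsHadamardSubdifferential φ x S) (hT : IsHadamardSubdifferential φ x T) : S ⊆ T := by
  intro v hv
  by_contra hvT
  obtain ⟨l, u, h1, h2⟩ :=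
    geometric_hahn_banach_closed_point hT.convex hT.isCompact.isClosed hvT
  obtain ⟨h, rfl⟩ := (InnerProductSpace.toDual ℝ E).surjective l
  obtain ⟨m, hm, hmd⟩ := hS.dirDeriv h
  obtain ⟨m', hm', hmd'⟩ := hT.dirDeriv h
  have hmm : m = m' := tendsto_nhds_unique hmd hmd'
  obtain ⟨w, hw, hw'⟩ := hm'.1
  have h3 := hm.2 (mem_image_of_mem _ hv)
  have h4 := h1 w hw
  simp only [InnerProductSpace.toDual_apply_apply] at h2 h4
  have e1 : inner ℝ h v = inner ℝ v h := real_inner_comm _ _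
  have e2 : inner ℝ h w = inner ℝ w h := real_inner_comm _ _
  simp only at hw' h3
  linarith

theorem hadamardSubdifferential_eq {E : Type*} [NormedAddCommGroup E]
    [InnerProductSpace ℝ E] [CompleteSpace E] {φ : E → ℝ} {x : E} {S : Set E}
    (hS : IsHadamardSubdifferential φ x S) : hadamardSubdifferential φ x = S :=
  Subset.antisymm (sUnion_subset fun _ hT => hT.subset hS)
    (subset_sUnion_of_mem (show S ∈ {S | IsHadamardSubdifferential φ x S} from hS))

end Derivatives

section Problem

variable {E : Type*} [NormedAddCommGroup E] [InnerProductSpace ℝ E]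
  {W : Type*} {Y : Type*} [NormedAddCommGroup Y] [NormedSpace ℝ Y]

/-- The objective function `F(x) = max_{ω ∈ W} f(x, ω)`. -/
def maxFun (f : E → W → ℝ) (x : E) : ℝ := ⨆ ω, f x ω

/-- The set of active indices `W(x) = {ω ∈ W | f(x, ω) = F(x)}`. -/
def activeSet (f : E → W → ℝ) (x : E) : Set W := {ω | f x ω = maxFun f x}

/-- The feasible region `Ω = {x ∈ A | G(x) ∈ K}`. -/
def feasibleSet (G : E → Y) (A : Set E) (K : Set Y) : Set E := {x | x ∈ A ∧ G x ∈ K}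

/-- The Lagrangian `L(x, l) = F(x) + ⟨l, G(x)⟩`. -/
def lagrangian (f : E → W → ℝ) (G : E → Y) (x : E) (l : StrongDual ℝ Y) : ℝ :=
  maxFun f x + l (G x)

/-- `l` is a Lagrange multiplier at `x`: `l ∈ K^*`, `⟨l, G(x)⟩ = 0`, and
`[L(·, l)]'(x, h) ≥ 0` for all `h ∈ T_A(x)`. -/
def IsLagrangeMultiplier (f : E → W → ℝ) (G : E → Y) (A : Set E) (K : Set Y) (x : E)
    (l : StrongDual ℝ Y) : Prop :=
  l ∈ polarCone K ∧ l (G x) = 0 ∧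
    ∀ h ∈ contingentCone A x, ∃ d : ℝ, HasDirDeriv (fun z => lagrangian f G z l) x h d ∧ 0 ≤ d

/-- The sufficient optimality condition: `max_{ω ∈ W(x)} ⟨∇ₓ f(x, ω), h⟩ > 0` for every nonzero
`h ∈ T_A(x)` with `DG(x) h ∈ T_K(G(x))`. -/
def SuffOptCond [CompleteSpace E] (f : E → W → ℝ) (G : E → Y) (A : Set E) (K : Set Y)
    (x : E) : Prop :=
  ∀ h ∈ contingentCone A x, h ≠ 0 → fderiv ℝ G x h ∈ contingentCone K (G x) →
    ∃ m : ℝ, IsGreatest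
      ((fun ω : W => inner ℝ (gradient (fun z => f z ω) x) h) '' activeSet f x) m ∧ 0 < m

/-- Robinson's constraint qualification: `0 ∈ int {G(x) + DG(x)(A - x) - K}`. -/
def RCQ (G : E → Y) (A : Set E) (K : Set Y) (x : E) : Prop :=
  (0 : Y) ∈ interior {y | ∃ a ∈ A, ∃ k ∈ K, y = G x + fderiv ℝ G x (a - x) - k}

/-- The penalty function `Φ_c(x) = F(x) + c dist(G(x), K)`. -/
def penaltyFun (f : E → W → ℝ) (G : E → Y) (K : Set Y) (c : ℝ) (x : E) : ℝ :=
  maxFun f x + c * Metric.infDist (G x) K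

/-- The first order growth condition for `φ` on the set `S` at `x`. -/
def FirstOrderGrowth (φ : E → ℝ) (S : Set E) (x : E) : Prop :=
  ∃ ρ > 0, ∃ O ∈ 𝓝 x, ∀ z ∈ O ∩ S, φ z ≥ φ x + ρ * ‖z - x‖

/-- `x` is a locally optimal solution of `min F` over the feasible region. -/
def IsLocallyOptimal (f : E → W → ℝ) (G : E → Y) (A : Set E) (K : Set Y) (x : E) : Prop :=
  x ∈ feasibleSet G A K ∧ IsLocalMinOn (maxFun f) (feasibleSet G A K) x

/-- Local exactness of the penalty function at `x`: for some `c₀ ≥ 0` and every `c ≥ c₀`, `x` is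
a local minimizer of `Φ_c` on `A`. -/
def PenaltyLocallyExact (f : E → W → ℝ) (G : E → Y) (A : Set E) (K : Set Y) (x : E) : Prop :=
  ∃ c₀ ≥ (0 : ℝ), ∀ c ≥ c₀, IsLocalMinOn (penaltyFun f G K c) A x

end Problem

end

end ConeMinimax

open ConeMinimax

/-! Write `T` for the contingent cone of `A` at `x`, `g h` for the largest inner product of `h` with
an active gradient, and `p h` for the distance from `DG(x) h` to the contingent cone of `K` at `G
x`. Danskin's theorem and convexity of `K` show that `Φ_c` has Hadamard derivative `q_c = g + c *
p`. This function is sublinear, so the Hadamard subdifferential of `Φ_c` is the set of linear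
minorants of `q_c`, and the conditions in the first two parts become sign conditions on `q_c` over
`T`.

By Hahn-Banach, `0` lies in the subdifferential plus the normal cone iff `q_c ≥ 0` on `T`, and in
its interior iff `q_c ≥ ρ‖·‖` on `T` for some `ρ > 0`; the latter is also first order growth of
`Φ_c` on `A` (`firstOrderGrowth_iff`). A multiplier `l` yields `q_c ≥ 0` with `c = ‖l‖`. Conversely,
the sandwich theorem `exists_linear_le_of_nonneg_on_cone`, applied to `c` times the distance to the
contingent cone of `K`, produces a multiplier. The sufficient condition says that `g > 0` on nonzero
`h ∈ T` with `p h = 0`, and compactness of the unit sphere of `T` turns this into positivity of some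
`q_c`.

For the last part, Robinson's condition gives the error bound `exists_error_bound`: points of `A`
near `x` have feasible points within a multiple of the constraint violation. Since `F` is locally
Lipschitz, moving to such a point costs at most a multiple of the penalty term, so minimality and
growth pass from the feasible set to `A`. -/

namespace ConeMinimax

/-- Real-valued sublinear functions: positively homogeneous and subadditive. -/
structure IsSublinear {V : Type*} [AddCommGroup V] [Module ℝ V] (q : V → ℝ) : Prop where
  smul : ∀ c : ℝ, 0 < c → ∀ x, q (c • x) = c * q x
  add : ∀ x y, q (x + y) ≤ q x + q y

/-- Convex cones containing the origin, as a predicate on sets. -/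
structure IsPointedCone {V : Type*} [AddCommGroup V] [Module ℝ V] (C : Set V) : Prop where
  zero_mem : (0 : V) ∈ C
  add_mem : ∀ x ∈ C, ∀ y ∈ C, x + y ∈ C
  smul_mem : ∀ c : ℝ, 0 < c → ∀ x ∈ C, c • x ∈ C

/-! ### Sublinear functions and the sandwich theorem. -/

section Sublinear

variable {V : Type*} [AddCommGroup V] [Module ℝ V] {V' : Type*} [AddCommGroup V'] [Module ℝ V']

theorem IsSublinear.map_zero {q : V → ℝ} (hq : IsSublinear q) : q 0 = 0 := by
  have := hq.smul 2 two_pos 0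
  rw [smul_zero] at this
  linarith

theorem IsSublinear.add_const_mul {p q : V → ℝ} (hp : IsSublinear p) (hq : IsSublinear q)
    {c : ℝ} (hc : 0 ≤ c) : IsSublinear fun x => p x + c * q x where
  smul t ht x := by
    rw [hp.smul t ht, hq.smul t ht]; ring
  add x y := by
    have := mul_le_mul_of_nonneg_left (hq.add x y) hc
    linarith [hp.add x y]

theorem IsSublinear.comp_linear {q : V' → ℝ} (hq : IsSublinear q) (D : V →ₗ[ℝ] V') :
    IsSublinear fun x => q (D x) where
  smul t ht x := by rw [map_smul, hq.smul t ht]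
  add x y := by rw [map_add]; exact hq.add _ _

/-- The sandwich form of the Hahn-Banach theorem for a sublinear function on the target of a
linear map and a sublinear function on its source. -/
theorem exists_linear_le_of_nonneg_on_cone {C : Set V} (hC : IsPointedCone C) {P : V' → ℝ}
    (hP : IsSublinear P) {g : V → ℝ} (hg : IsSublinear g) (D : V →ₗ[ℝ] V')
    (h : ∀ v ∈ C, 0 ≤ P (D v) + g v) :
    ∃ l : V' →ₗ[ℝ] ℝ, (∀ y, l y ≤ P y) ∧ ∀ v ∈ C, 0 ≤ l (D v) + g v := by
  have : Nonempty C := ⟨⟨0, hC.zero_mem⟩⟩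
  -- An infimal convolution, finite because `h` supplies the lower bound `-P (-y)`. Taking `v = 0`
  -- gives `r ≤ P`, and `r (-(D v)) ≤ g v`, so every linear minorant of `r` has both required
  -- properties.
  set r : V' → ℝ := fun y => ⨅ v : C, (P (y + D v) + g v) with hr
  have hbdd : ∀ y, BddBelow (range fun v : C => P (y + D v) + g v) := by
    intro y
    refine ⟨-P (-y), ?_⟩
    rintro _ ⟨v, rfl⟩
    have h1 := hP.add (y + D v) (-y)
    rw [add_neg_cancel_comm] at h1
    have h2 := h v v.2
    dsimp only
    linarith
  have hsm : ∀ c : ℝ, 0 < c → ∀ y, r (c • y) ≤ c * r y := by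
    intro c hc y
    simp only [hr]
    rw [Real.mul_iInf_of_nonneg hc.le]
    refine le_ciInf fun v => ?_
    refine (ciInf_le (hbdd _) ⟨c • (v : V), hC.smul_mem c hc v v.2⟩).trans_eq ?_
    simp only [map_smul]
    rw [← smul_add, hP.smul c hc, hg.smul c hc, mul_add]
  have hle : ∀ y, ∀ v ∈ C, r y ≤ P (y + D v) + g v := fun y v hv => ciInf_le (hbdd y) ⟨v, hv⟩
  have hradd : ∀ y z, r (y + z) ≤ r y + r z := by
    intro y z
    refine le_ciInf_add_ciInf fun v w => ?_
    refine (hle _ _ (hC.add_mem v v.2 w w.2)).trans ?_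
    have h1 := hP.add (y + D v) (z + D w)
    have h2 := hg.add (v : V) w
    rw [map_add, add_add_add_comm]
    linarith
  have hrsm : ∀ c : ℝ, 0 < c → ∀ y, r (c • y) = c * r y := by
    intro c hc y
    refine le_antisymm (hsm c hc y) ?_
    have h1 := hsm c⁻¹ (inv_pos.2 hc) (c • y)
    rw [inv_smul_smul₀ hc.ne'] at h1
    calc c * r y ≤ c * (c⁻¹ * r (c • y)) := mul_le_mul_of_nonneg_left h1 hc.le
      _ = r (c • y) := by rw [mul_inv_cancel_left₀ hc.ne']
  have hr0 : r 0 = 0 := IsSublinear.map_zero ⟨hrsm, hradd⟩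
  -- Extending from the zero subspace only requires `0 ≤ r 0`.
  obtain ⟨l, -, hl⟩ := exists_extension_of_le_sublinear (⊥ : V' →ₗ.[ℝ] ℝ) r hrsm hradd (by
    rintro ⟨y, hy⟩
    have hy0 : y = 0 := (Submodule.mem_bot ℝ).1 hy
    subst hy0
    have : (⟨0, hy⟩ : (⊥ : V' →ₗ.[ℝ] ℝ).domain) = 0 := rfl
    rw [this, LinearPMap.map_zero]
    exact hr0.ge)
  refine ⟨l, fun y => (hl y).trans ?_, fun v hv => ?_⟩
  · have := hle y 0 hC.zero_mem
    rwa [map_zero, add_zero, hg.map_zero, add_zero] at this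
  · have h1 := (hl (-(D v))).trans (hle _ v hv)
    rw [neg_add_cancel, hP.map_zero, map_neg] at h1
    linarith

end Sublinear

/-! ### Contingent cones of convex sets and distances to cones. -/

section Cone

variable {X : Type*} [NormedAddCommGroup X] [NormedSpace ℝ X]

theorem Convex.add_smul_mem_of_le {C : Set X} (hC : Convex ℝ C) {x u : X} (hx : x ∈ C) {s t : ℝ}
    (hs : 0 ≤ s) (hst : s ≤ t) (hu : x + t • u ∈ C) : x + s • u ∈ C := by
  rcases hs.eq_or_lt with rfl | hs
  · simpa using hx
  have ht : 0 < t := hs.trans_le hst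
  have h1 := hC.add_smul_mem hx hu ⟨div_nonneg hs.le ht.le, (div_le_one ht).2 hst⟩
  rwa [smul_smul, div_mul_cancel₀ _ ht.ne'] at h1

/-- By convexity a feasible step may be shortened at will, so the requirement that the step lengths
tend to zero costs nothing. -/
theorem contingentCone_eq_closure {C : Set X} (hC : Convex ℝ C) {x : X} (hx : x ∈ C) :
    contingentCone C x = closure {u | ∃ t : ℝ, 0 < t ∧ x + t • u ∈ C} := by
  ext h
  constructor
  · rintro ⟨α, u, hα, -, hu, hm⟩
    exact mem_closure_of_tendsto hu (Eventually.of_forall fun n => ⟨α n, hα n, hm n⟩)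
  · intro hh
    obtain ⟨u, hu, hlim⟩ := mem_closure_iff_seq_limit.1 hh
    choose t ht hmem using hu
    -- Capping by `1 / (n + 1)` forces the step lengths to zero.
    refine ⟨fun n => min (t n) (1 / ((n : ℝ) + 1)), u, fun n => lt_min (ht n) (by positivity),
      ?_, hlim, fun n => ?_⟩
    · exact squeeze_zero (fun n => (lt_min (ht n) (by positivity)).le)
        (fun n => min_le_right _ _) tendsto_one_div_add_atTop_nhds_zero_nat
    · exact Convex.add_smul_mem_of_le hC hx (lt_min (ht n) (by positivity)).le
        (min_le_left _ _) (hmem n)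

theorem isClosed_contingentCone {C : Set X} (hC : Convex ℝ C) {x : X} (hx : x ∈ C) :
    IsClosed (contingentCone C x) := by
  rw [contingentCone_eq_closure hC hx]
  exact isClosed_closure

theorem sub_mem_contingentCone {C : Set X} (hC : Convex ℝ C) {x y : X} (hx : x ∈ C) (hy : y ∈ C)
    {t : ℝ} (ht : 0 < t) : t • (y - x) ∈ contingentCone C x := by
  rw [contingentCone_eq_closure hC hx]
  refine subset_closure ⟨t⁻¹, inv_pos.2 ht, ?_⟩
  rw [inv_smul_smul₀ ht.ne']
  simpa using hy

theorem isPointedCone_contingentCone {C : Set X} (hC : Convex ℝ C) {x : X} (hx : x ∈ C) :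
    IsPointedCone (contingentCone C x) := by
  rw [contingentCone_eq_closure hC hx]
  refine ⟨subset_closure ⟨1, one_pos, by simpa using hx⟩, fun u hu v hv => ?_, fun c hc u hu => ?_⟩
  · refine map_mem_closure₂ continuous_add hu hv ?_
    rintro a ⟨s, hs, hsa⟩ b ⟨t, ht, htb⟩
    have hm : 0 < min s t := lt_min hs ht
    have h1 := Convex.add_smul_mem_of_le hC hx hm.le (min_le_left _ _) hsa
    have h2 := Convex.add_smul_mem_of_le hC hx hm.le (min_le_right _ _) htb
    refine ⟨min s t / 2, half_pos hm, ?_⟩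
    have h3 := hC h1 h2 (a := 1 / 2) (b := 1 / 2) (by norm_num) (by norm_num) (by norm_num)
    convert h3 using 1
    module
  · refine map_mem_closure (continuous_const_smul c) hu ?_
    rintro a ⟨s, hs, hsa⟩
    refine ⟨s / c, div_pos hs hc, ?_⟩
    rwa [smul_smul, div_mul_cancel₀ _ hc.ne']

theorem isSublinear_infDist {T : Set X} (hT : IsPointedCone T) :
    IsSublinear fun v => Metric.infDist v T := by
  have hne : T.Nonempty := ⟨0, hT.zero_mem⟩
  have hle : ∀ c : ℝ, 0 < c → ∀ x, Metric.infDist (c • x) T ≤ c * Metric.infDist x T := by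
    intro c hc x
    refine le_of_forall_pos_lt_add fun ε hε => ?_
    obtain ⟨y, hy, hyd⟩ := (Metric.infDist_lt_iff hne).1
      (lt_add_of_pos_right (Metric.infDist x T) (div_pos hε hc))
    refine (Metric.infDist_le_dist_of_mem (hT.smul_mem c hc y hy)).trans_lt ?_
    rw [dist_smul₀, Real.norm_of_nonneg hc.le]
    have := mul_lt_mul_of_pos_left hyd hc
    rwa [mul_add, mul_div_cancel₀ _ hc.ne'] at this
  refine ⟨fun c hc x => le_antisymm (hle c hc x) ?_, fun x y => ?_⟩
  · have h1 := hle c⁻¹ (inv_pos.2 hc) (c • x)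
    rw [inv_smul_smul₀ hc.ne'] at h1
    calc c * Metric.infDist x T ≤ c * (c⁻¹ * Metric.infDist (c • x) T) :=
          mul_le_mul_of_nonneg_left h1 hc.le
      _ = _ := by rw [mul_inv_cancel_left₀ hc.ne']
  · refine le_of_forall_pos_lt_add fun ε hε => ?_
    obtain ⟨a, ha, had⟩ := (Metric.infDist_lt_iff hne).1
      (lt_add_of_pos_right (Metric.infDist x T) (half_pos hε))
    obtain ⟨b, hb, hbd⟩ := (Metric.infDist_lt_iff hne).1
      (lt_add_of_pos_right (Metric.infDist y T) (half_pos hε))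
    refine (Metric.infDist_le_dist_of_mem (hT.add_mem a ha b hb)).trans_lt ?_
    refine (dist_add_add_le x y a b).trans_lt ?_
    linarith

/-- Subadditivity gives `q v - q w ≤ q (v - w)`, so a linear upper bound is already a Lipschitz
bound. -/
theorem IsSublinear.continuous {q : X → ℝ} (hq : IsSublinear q) {M : ℝ}
    (hM : ∀ v, q v ≤ M * ‖v‖) : Continuous q := by
  refine (LipschitzWith.of_le_add_mul (Real.toNNReal M) fun v w => ?_).continuous
  have h1 := hq.add w (v - w)
  rw [add_sub_cancel] at h1
  refine h1.trans (add_le_add_right ((hM _).trans ?_) _)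
  rw [dist_eq_norm]
  exact mul_le_mul_of_nonneg_right (Real.le_coe_toNNReal M) (norm_nonneg _)

theorem HasHadamardDirDeriv.tendsto_seq {φ : X → ℝ} {x h : X} {m : ℝ}
    (hφ : HasHadamardDirDeriv φ x h m) {α : ℕ → ℝ} {u : ℕ → X} (hα : ∀ n, 0 < α n)
    (hα0 : Tendsto α atTop (𝓝 0)) (hu : Tendsto u atTop (𝓝 h)) :
    Tendsto (fun n => (φ (x + α n • u n) - φ x) / α n) atTop (𝓝 m) := by
  have h1 : Tendsto α atTop (𝓝[>] 0) :=
    tendsto_nhdsWithin_iff.2 ⟨hα0, Eventually.of_forall fun n => mem_Ioi.2 (hα n)⟩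
  have h2 := Tendsto.comp hφ (h1.prodMk hu)
  exact h2

end Cone

/-! ### Support functions, normal cones and first order growth. -/

section Subdifferential

variable {E : Type*} [NormedAddCommGroup E] [InnerProductSpace ℝ E] [FiniteDimensional ℝ E]

theorem IsSublinear.exists_inner_le {q : E → ℝ} (hq : IsSublinear q) {C : Set E}
    (hC : IsPointedCone C) (h : ∀ v ∈ C, 0 ≤ q v) :
    ∃ w : E, (∀ v, inner ℝ w v ≤ q v) ∧ ∀ v ∈ C, 0 ≤ inner ℝ w v := by
  obtain ⟨l, h1, h2⟩ := exists_linear_le_of_nonneg_on_cone hC hq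
    (g := fun _ => 0) ⟨by simp, by simp⟩ LinearMap.id (by simpa using h)
  have := FiniteDimensional.complete ℝ E
  refine ⟨(InnerProductSpace.toDual ℝ E).symm (LinearMap.toContinuousLinearMap l), ?_, ?_⟩
  · intro v
    rw [InnerProductSpace.toDual_symm_apply]
    exact h1 v
  · intro v hv
    rw [InnerProductSpace.toDual_symm_apply]
    simpa using h2 v hv

/-- The sandwich theorem on the half-line of `t ≥ 0`, with `t ↦ t • h` and `g t = -(t * q h)`,
forces the minorant to be at least `q h` at `h`. -/
theorem IsSublinear.exists_inner_eq {q : E → ℝ} (hq : IsSublinear q) (h : E) :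
    ∃ w : E, (∀ v, inner ℝ w v ≤ q v) ∧ inner ℝ w h = q h := by
  have hC : IsPointedCone {t : ℝ | 0 ≤ t} :=
    ⟨le_refl (0 : ℝ), fun _ hx _ hy => add_nonneg (α := ℝ) hx hy,
      fun _ hc _ hx => mul_nonneg (α := ℝ) hc.le hx⟩
  obtain ⟨l, h1, h2⟩ := exists_linear_le_of_nonneg_on_cone hC hq
    (g := fun t : ℝ => -(t * q h))
    ⟨fun c _ x => by simp only [smul_eq_mul]; ring, fun x y => le_of_eq (by ring)⟩
    (LinearMap.toSpanSingleton ℝ E h) (by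
      intro t ht
      rw [LinearMap.toSpanSingleton_apply]
      rcases (show 0 ≤ t from ht).eq_or_lt with rfl | ht
      · simp [hq.map_zero]
      · rw [hq.smul t ht]; simp)
  have := FiniteDimensional.complete ℝ E
  have key : ∀ v, inner ℝ ((InnerProductSpace.toDual ℝ E).symm
      (LinearMap.toContinuousLinearMap l)) v = l v := fun v =>
    InnerProductSpace.toDual_symm_apply
  refine ⟨(InnerProductSpace.toDual ℝ E).symm (LinearMap.toContinuousLinearMap l), ?_, ?_⟩
  · intro v
    rw [key]
    exact h1 v
  · rw [key]
    have h3 := h2 1 (show (0 : ℝ) ≤ 1 by norm_num)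
    rw [LinearMap.toSpanSingleton_apply, one_smul] at h3
    linarith [h1 h]

/-- The set is an intersection of closed half-spaces; testing `v = w` bounds it by `max M 0`. Its
support function is exactly `q` by `exists_inner_eq`. -/
theorem IsSublinear.isHadamardSubdifferential {q : E → ℝ} (hq : IsSublinear q) {M : ℝ}
    (hM : ∀ v, q v ≤ M * ‖v‖) {φ : E → ℝ} {x : E} (hφ : ∀ h, HasHadamardDirDeriv φ x h (q h)) :
    IsHadamardSubdifferential φ x {w | ∀ v, inner ℝ w v ≤ q v} where
  convex := by
    intro a ha b hb s t hs ht hst v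
    rw [inner_add_left, inner_smul_left, inner_smul_left]
    simp only [conj_trivial]
    have h1 := mul_le_mul_of_nonneg_left (ha v) hs
    have h2 := mul_le_mul_of_nonneg_left (hb v) ht
    calc _ ≤ s * q v + t * q v := add_le_add h1 h2
      _ = q v := by rw [← add_mul, hst, one_mul]
  isCompact := by
    have := FiniteDimensional.proper_real E
    refine Metric.isCompact_of_isClosed_isBounded ?_ ?_
    · simp only [ofPred_forall]
      exact isClosed_iInter fun v => isClosed_le (by fun_prop) continuous_const
    · refine Metric.isBounded_closedBall (x := (0 : E)) (r := max M 0) |>.subset fun w hw => ?_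
      rw [mem_closedBall_zero_iff]
      by_contra! hlt
      have h1 := (hw w).trans (hM w)
      rw [real_inner_self_eq_norm_mul_norm] at h1
      have h0 : 0 < ‖w‖ := (le_max_right _ _).trans_lt hlt
      exact absurd (le_of_mul_le_mul_right h1 h0) (not_le.2 ((le_max_left _ _).trans_lt hlt))
  dirDeriv h := by
    obtain ⟨w, hw, hwh⟩ := hq.exists_inner_eq h
    refine ⟨q h, ⟨⟨w, hw, hwh⟩, ?_⟩, hφ h⟩
    rintro _ ⟨v, hv, rfl⟩
    exact hv h

/-- `0 ∈ S + N_A(x)` for the set `S` with support function `q` means `q ≥ 0` on `T_A(x)`. -/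
theorem IsSublinear.zero_mem_add_normalCone_iff {q : E → ℝ} (hq : IsSublinear q) {A : Set E}
    {x : E} (hT : IsPointedCone (contingentCone A x)) :
    (0 : E) ∈ {w | ∀ v, inner ℝ w v ≤ q v} + normalCone A x ↔
      ∀ h ∈ contingentCone A x, 0 ≤ q h := by
  constructor
  · rintro ⟨v, hv, n, hn, hvn⟩ h hh
    have h1 : inner ℝ v h + inner ℝ n h = 0 := by
      rw [← inner_add_left]
      simp only at hvn
      rw [hvn, inner_zero_left]
    linarith [hn h hh, hv h]
  · intro h
    obtain ⟨w, hw, hwC⟩ := hq.exists_inner_le hT h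
    refine ⟨w, hw, -w, fun v hv => ?_, add_neg_cancel w⟩
    rw [inner_neg_left]
    linarith [hwC v hv]

/-- A vector `z` lies in the sum when `q - ⟨z, ·⟩ ≥ 0` on the cone, which holds for all `‖z‖ < ρ` if
`q ≥ ρ‖·‖` there. Conversely, multiples of `h` inside the ball recover the bound at `h`. -/
theorem IsSublinear.zero_mem_interior_add_normalCone_iff {q : E → ℝ} (hq : IsSublinear q)
    {A : Set E} {x : E} (hT : IsPointedCone (contingentCone A x)) :
    (0 : E) ∈ interior ({w | ∀ v, inner ℝ w v ≤ q v} + normalCone A x) ↔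
      ∃ ρ > 0, ∀ h ∈ contingentCone A x, ρ * ‖h‖ ≤ q h := by
  rw [mem_interior_iff_mem_nhds, Metric.mem_nhds_iff]
  constructor
  · rintro ⟨ε, hε, hsub⟩
    refine ⟨ε / 2, half_pos hε, fun h hh => ?_⟩
    rcases eq_or_ne h 0 with rfl | h0
    · simp [hq.map_zero]
    have hn : 0 < ‖h‖ := norm_pos_iff.2 h0
    have hmem : (ε / 2 / ‖h‖) • h ∈ Metric.ball (0 : E) ε := by
      rw [mem_ball_zero_iff, norm_smul, Real.norm_of_nonneg (by positivity),
        div_mul_cancel₀ _ hn.ne']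
      linarith
    obtain ⟨v, hv, n, hn', hvn⟩ := hsub hmem
    have h1 : inner ℝ v h + inner ℝ n h = ε / 2 * ‖h‖ := by
      rw [← inner_add_left]
      simp only at hvn
      rw [hvn, inner_smul_left, real_inner_self_eq_norm_mul_norm]
      simp only [conj_trivial]
      field_simp
    linarith [hn' h hh, hv h]
  · rintro ⟨ρ, hρ, h⟩
    refine ⟨ρ, hρ, fun z hz => ?_⟩
    rw [mem_ball_zero_iff] at hz
    have hq' : IsSublinear fun v => q v + 1 * (innerₗ E (-z) v) :=
      hq.add_const_mul ⟨fun c _ v => by simp, fun v w => by rw [map_add]⟩ zero_le_one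
    obtain ⟨w, hw, hwC⟩ := hq'.exists_inner_le hT (by
      intro v hv
      have h1 := h v hv
      have h2 := real_inner_le_norm z v
      have h3 := mul_le_mul_of_nonneg_right hz.le (norm_nonneg v)
      simp only [innerₗ_apply_apply, inner_neg_left]
      linarith)
    refine ⟨w + z, fun v => ?_, -w, fun v hv => ?_, by simp⟩
    · have := hw v
      simp only [innerₗ_apply_apply, inner_neg_left] at this
      rw [inner_add_left]
      linarith
    · rw [inner_neg_left]
      linarith [hwC v hv]

theorem isCompact_inter_sphere {T : Set E} (hT : IsClosed T) :
    IsCompact (T ∩ Metric.sphere (0 : E) 1) := by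
  have := FiniteDimensional.proper_real E
  exact (isCompact_sphere 0 1).inter_left hT

theorem IsSublinear.forall_pos_iff {q : E → ℝ} (hq : IsSublinear q) {M : ℝ}
    (hM : ∀ v, q v ≤ M * ‖v‖) {T : Set E} (hTc : IsPointedCone T) (hT : IsClosed T) :
    (∀ h ∈ T, h ≠ 0 → 0 < q h) ↔ ∃ ρ > 0, ∀ h ∈ T, ρ * ‖h‖ ≤ q h := by
  constructor
  · intro h
    obtain ⟨ρ, hρ, hρq⟩ : ∃ ρ > 0, ∀ v ∈ T ∩ Metric.sphere (0 : E) 1, ρ ≤ q v := by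
      rcases (T ∩ Metric.sphere (0 : E) 1).eq_empty_or_nonempty with he | hne
      · exact ⟨1, one_pos, by simp [he]⟩
      · obtain ⟨v, hv, hmin⟩ := (isCompact_inter_sphere hT).exists_isMinOn hne
          (hq.continuous hM).continuousOn
        exact ⟨q v, h v hv.1 (ne_zero_of_mem_unit_sphere ⟨v, hv.2⟩), fun w hw => hmin hw⟩
    refine ⟨ρ, hρ, fun v hv => ?_⟩
    rcases eq_or_ne v 0 with rfl | h0
    · simp [hq.map_zero]
    have hn : 0 < ‖v‖ := norm_pos_iff.2 h0
    have h1 := hρq (‖v‖⁻¹ • v) ⟨hTc.smul_mem _ (inv_pos.2 hn) v hv, by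
      rw [mem_sphere_zero_iff_norm, norm_smul, norm_inv, norm_norm, inv_mul_cancel₀ hn.ne']⟩
    rw [hq.smul _ (inv_pos.2 hn), inv_mul_eq_div, le_div_iff₀ hn] at h1
    exact h1
  · rintro ⟨ρ, hρ, h⟩ v hv h0
    exact (mul_pos hρ (norm_pos_iff.2 h0)).trans_le (h v hv)

/-- Exact penalisation of the constraint `p = 0` for sublinear functions on a closed cone. -/
theorem forall_pos_of_eq_zero_iff_exists_penalty {g p : E → ℝ} (hg : IsSublinear g)
    (hp : IsSublinear p) {L M : ℝ} (hL : ∀ v, g v ≤ L * ‖v‖) (hM : ∀ v, p v ≤ M * ‖v‖)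
    (hp0 : ∀ v, 0 ≤ p v) {T : Set E} (hTc : IsPointedCone T) (hT : IsClosed T) :
    (∀ h ∈ T, h ≠ 0 → p h = 0 → 0 < g h) ↔ ∃ c ≥ 0, ∀ h ∈ T, h ≠ 0 → 0 < g h + c * p h := by
  constructor
  · intro h
    have hgc := hg.continuous hL
    have hpc := hp.continuous hM
    -- The open sets where `g + n * p > 0` increase with `n` because `p ≥ 0`, and cover the unit
    -- sphere of `T`: the hypothesis handles `p v = 0`, a large `n` handles `p v > 0`.
    obtain ⟨n, hn⟩ := (isCompact_inter_sphere hT).elim_directed_cover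
      (fun n : ℕ => {v | 0 < g v + n * p v})
      (fun n => isOpen_lt continuous_const (by fun_prop)) (by
        intro v hv
        rw [mem_iUnion]
        rcases (hp0 v).eq_or_lt with h0 | h0
        · refine ⟨0, ?_⟩
          have := h v hv.1 (ne_zero_of_mem_unit_sphere ⟨v, hv.2⟩) h0.symm
          simpa using this
        · obtain ⟨n, hn⟩ := exists_nat_gt (-g v / p v)
          rw [div_lt_iff₀ h0] at hn
          exact ⟨n, show 0 < g v + n * p v by linarith⟩)
      (Monotone.directed_le (by
        intro m n hmn v hv
        have h1 := mul_le_mul_of_nonneg_right (Nat.cast_le (α := ℝ).2 hmn) (hp0 v)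
        have h2 : 0 < g v + m * p v := hv
        show 0 < g v + n * p v
        linarith))
    refine ⟨n, Nat.cast_nonneg n, fun v hv h0 => ?_⟩
    have hv0 : 0 < ‖v‖ := norm_pos_iff.2 h0
    have h1 := hn ⟨hTc.smul_mem _ (inv_pos.2 hv0) v hv, by
      rw [mem_sphere_zero_iff_norm, norm_smul, norm_inv, norm_norm, inv_mul_cancel₀ hv0.ne']⟩
    have h2 : 0 < g (‖v‖⁻¹ • v) + n * p (‖v‖⁻¹ • v) := h1
    rw [hg.smul _ (inv_pos.2 hv0), hp.smul _ (inv_pos.2 hv0), mul_left_comm, ← mul_add] at h2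
    exact pos_of_mul_pos_right h2 (inv_pos.2 hv0).le
  · rintro ⟨c, -, h⟩ v hv h0 hpv
    simpa [hpv] using h v hv h0

/-- First order growth along a convex set is detected by the Hadamard derivative on the
contingent cone. -/
theorem firstOrderGrowth_iff {φ q : E → ℝ} {A : Set E} {x : E}
    (hφ : ∀ h, HasHadamardDirDeriv φ x h (q h)) :
    FirstOrderGrowth φ A x ↔ ∃ ρ > 0, ∀ h ∈ contingentCone A x, ρ * ‖h‖ ≤ q h := by
  constructor
  · rintro ⟨ρ, hρ, U, hU, hg⟩
    refine ⟨ρ, hρ, ?_⟩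
    rintro h ⟨α, u, hα, hα0, hu, hm⟩
    have hlim := (hφ h).tendsto_seq hα hα0 hu
    have hx : Tendsto (fun n => x + α n • u n) atTop (𝓝 x) := by
      simpa using tendsto_const_nhds.add (hα0.smul hu)
    refine le_of_tendsto_of_tendsto (hu.norm.const_mul ρ) hlim ?_
    filter_upwards [hx hU] with n hn
    have h1 := hg _ ⟨hn, hm n⟩
    rw [add_sub_cancel_left, norm_smul, Real.norm_of_nonneg (hα n).le] at h1
    rw [le_div_iff₀ (hα n)]
    linarith
  · rintro ⟨ρ, hρ, hq⟩
    -- If growth with rate `ρ / 2` fails along a sequence tending to `x`, the normalised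
    -- displacements subconverge to a unit tangent direction `h` with `q h ≤ ρ / 2`, contradicting
    -- `q h ≥ ρ`.
    by_contra hcon
    have key : ∀ n : ℕ, ∃ z ∈ Metric.ball x (1 / ((n : ℝ) + 1)) ∩ A,
        φ z < φ x + ρ / 2 * ‖z - x‖ := by
      intro n
      by_contra! hc
      exact hcon ⟨ρ / 2, half_pos hρ, _, Metric.ball_mem_nhds x (by positivity), hc⟩
    choose z hz hzlt using key
    have hne : ∀ n, 0 < ‖z n - x‖ := by
      intro n
      refine norm_pos_iff.2 fun h0 => ?_
      have h1 := hzlt n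
      rw [h0, norm_zero, sub_eq_zero.1 h0] at h1
      simp at h1
    have hsph : ∀ n, ‖z n - x‖⁻¹ • (z n - x) ∈ Metric.sphere (0 : E) 1 := by
      intro n
      rw [mem_sphere_zero_iff_norm, norm_smul, norm_inv, norm_norm, inv_mul_cancel₀ (hne n).ne']
    have := FiniteDimensional.proper_real E
    obtain ⟨h, hh, k, hk, hlim⟩ := (isCompact_sphere (0 : E) 1).tendsto_subseq hsph
    have hα0 : Tendsto (fun n => ‖z n - x‖) atTop (𝓝 0) := by
      refine squeeze_zero (fun n => norm_nonneg _) (fun n => ?_)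
        tendsto_one_div_add_atTop_nhds_zero_nat
      have := (hz n).1
      rw [mem_ball_iff_norm] at this
      exact this.le
    have hsm : ∀ n, x + ‖z n - x‖ • ‖z n - x‖⁻¹ • (z n - x) = z n := by
      intro n
      rw [smul_inv_smul₀ (hne n).ne', add_sub_cancel]
    have hαk := hα0.comp hk.tendsto_atTop
    have hT : h ∈ contingentCone A x :=
      ⟨_, _, fun n => hne (k n), hαk, hlim, fun n => by
        simp only [Function.comp_apply]
        rw [hsm]; exact (hz _).2⟩
    have hd := (hφ h).tendsto_seq (fun n => hne (k n)) hαk hlim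
    have hle : q h ≤ ρ / 2 := by
      refine le_of_tendsto hd (Eventually.of_forall fun n => ?_)
      simp only [Function.comp_apply]
      rw [hsm, div_le_iff₀ (hne _)]
      linarith [hzlt (k n)]
    have h1 := hq h hT
    rw [mem_sphere_zero_iff_norm.1 hh] at h1
    linarith

end Subdifferential

/-! ### Attainment of the maximum over the compact index set. -/

section Attainment

variable {E : Type*} [TopologicalSpace E] {W : Type*} [TopologicalSpace W] {f : E → W → ℝ}
  {O : Set E}

theorem continuous_of_continuousOn_prod
    (hf_cont : ContinuousOn (fun p : E × W => f p.1 p.2) (O ×ˢ univ)) {z : E} (hz : z ∈ O) :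
    Continuous (f z) := by
  have h1 : Continuous fun ω : W => (z, ω) := by fun_prop
  exact hf_cont.comp_continuous h1 fun ω => ⟨hz, mem_univ ω⟩

variable [CompactSpace W]

theorem le_maxFun (hf_cont : ContinuousOn (fun p : E × W => f p.1 p.2) (O ×ˢ univ)) {z : E}
    (hz : z ∈ O) (ω : W) : f z ω ≤ maxFun f z :=
  le_ciSup (isCompact_range (continuous_of_continuousOn_prod hf_cont hz)).bddAbove ω

theorem exists_eq_maxFun [Nonempty W]
    (hf_cont : ContinuousOn (fun p : E × W => f p.1 p.2) (O ×ˢ univ)) {z : E} (hz : z ∈ O) :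
    ∃ ω, f z ω = maxFun f z := by
  obtain ⟨ω, -, hω⟩ := isCompact_univ.exists_isMaxOn univ_nonempty
    (continuous_of_continuousOn_prod hf_cont hz).continuousOn
  exact ⟨ω, le_antisymm (le_maxFun hf_cont hz ω) (ciSup_le fun ω' => hω (mem_univ ω'))⟩

theorem isCompact_activeSet (hf_cont : ContinuousOn (fun p : E × W => f p.1 p.2) (O ×ˢ univ))
    {z : E} (hz : z ∈ O) : IsCompact (activeSet f z) :=
  (isClosed_eq (continuous_of_continuousOn_prod hf_cont hz) continuous_const).isCompact

end Attainment

theorem tendsto_add_smul_hadamard {E : Type*} [NormedAddCommGroup E] [NormedSpace ℝ E] (x h : E) :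
    Tendsto (fun p : ℝ × E => x + p.1 • p.2) (𝓝[>] 0 ×ˢ 𝓝 h) (𝓝 x) := by
  have h1 : Tendsto (fun p : ℝ × E => p.1) (𝓝[>] 0 ×ˢ 𝓝 h) (𝓝 0) :=
    (tendsto_nhdsWithin_iff.1 tendsto_fst).1
  have h2 : Tendsto (fun p : ℝ × E => p.2) (𝓝[>] 0 ×ˢ 𝓝 h) (𝓝 h) := tendsto_snd
  simpa using tendsto_const_nhds.add (h1.smul h2)

theorem eventually_pos_hadamard {E : Type*} [NormedAddCommGroup E] (h : E) :
    ∀ᶠ p : ℝ × E in 𝓝[>] 0 ×ˢ 𝓝 h, 0 < p.1 :=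
  (tendsto_nhdsWithin_iff.1 (tendsto_fst (f := 𝓝[>] (0 : ℝ)) (g := 𝓝 h))).2

/-! ### Lipschitz continuity and Danskin's theorem for the maximum function. -/

section MaxFunction

variable {E : Type*} [NormedAddCommGroup E] [InnerProductSpace ℝ E]
  {W : Type*} [TopologicalSpace W] {f : E → W → ℝ} {O : Set E} {x : E}

/-- The mean value inequality on a ball where all gradients are `ε`-close to the one at `(x, ω)`.
One radius serves a whole neighbourhood of `ω`, which is what compactness of `W` needs. -/
theorem exists_uniform_strict_differentiability [CompleteSpace E] (hO : IsOpen O) (hxO : x ∈ O)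
    (hf_diff : ∀ z ∈ O, ∀ ω : W, DifferentiableAt ℝ (fun z => f z ω) z)
    (hf_grad : ContinuousOn (fun p : E × W => gradient (fun z => f z p.2) p.1) (O ×ˢ univ))
    (ω : W) {ε : ℝ} (hε : 0 < ε) :
    ∃ r > 0, ∃ V ∈ 𝓝 ω, ∀ ω' ∈ V, ∀ z₁ ∈ Metric.ball x r, ∀ z₂ ∈ Metric.ball x r,
      |f z₁ ω' - f z₂ ω' - inner ℝ (gradient (fun z => f z ω) x) (z₁ - z₂)| ≤
        ε * ‖z₁ - z₂‖ := by
  have hc := hf_grad.continuousAt (x := (x, ω))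
    ((hO.prod isOpen_univ).mem_nhds ⟨hxO, mem_univ ω⟩)
  have h1 := hc (Metric.ball_mem_nhds _ hε)
  rw [mem_map, nhds_prod_eq, mem_prod_iff] at h1
  obtain ⟨U, hU, V, hV, hUV⟩ := h1
  obtain ⟨r, hr, hball⟩ := Metric.mem_nhds_iff.1 (inter_mem hU (hO.mem_nhds hxO))
  refine ⟨r, hr, V, hV, fun ω' hω' z₁ hz₁ z₂ hz₂ => ?_⟩
  have h2 := Convex.norm_image_sub_le_of_norm_hasFDerivWithin_le' (𝕜 := ℝ) (C := ε)
    (f := fun z => f z ω') (s := Metric.ball x r)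
    (f' := fun z => InnerProductSpace.toDual ℝ E (gradient (fun z => f z ω') z))
    (φ := InnerProductSpace.toDual ℝ E (gradient (fun z => f z ω) x))
    (fun z hz => ((hf_diff z (hball hz).2 ω').hasGradientAt.hasFDerivAt).hasFDerivWithinAt)
    (fun z hz => by
      have h3 := hUV (mk_mem_prod (hball hz).1 hω')
      rw [mem_preimage, mem_ball_iff_norm] at h3
      rw [← map_sub, LinearIsometryEquiv.norm_map]
      exact h3.le)
    (convex_ball x r) hz₂ hz₁
  rwa [InnerProductSpace.toDual_apply_apply, Real.norm_eq_abs] at h2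

variable [CompactSpace W]

theorem exists_lipschitz_maxFun [CompleteSpace E] [Nonempty W] (hO : IsOpen O) (hxO : x ∈ O)
    (hf_cont : ContinuousOn (fun p : E × W => f p.1 p.2) (O ×ˢ univ))
    (hf_diff : ∀ z ∈ O, ∀ ω : W, DifferentiableAt ℝ (fun z => f z ω) z)
    (hf_grad : ContinuousOn (fun p : E × W => gradient (fun z => f z p.2) p.1) (O ×ˢ univ)) :
    ∃ L ≥ 0, ∃ r > 0, ∀ z₁ ∈ Metric.ball x r, ∀ z₂ ∈ Metric.ball x r,
      maxFun f z₁ ≤ maxFun f z₂ + L * ‖z₁ - z₂‖ := by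
  have h1 : ∃ L ≥ 0, ∃ r > 0, ∀ ω ∈ (univ : Set W), ∀ z₁ ∈ Metric.ball x r,
      ∀ z₂ ∈ Metric.ball x r, f z₁ ω ≤ f z₂ ω + L * ‖z₁ - z₂‖ := by
    -- The property passes to subsets and finite unions, so it suffices to verify it near each
    -- index.
    refine isCompact_univ.induction_on (p := fun S => ∃ L ≥ (0 : ℝ), ∃ r > 0, ∀ ω ∈ S,
      ∀ z₁ ∈ Metric.ball x r, ∀ z₂ ∈ Metric.ball x r, f z₁ ω ≤ f z₂ ω + L * ‖z₁ - z₂‖)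
      ⟨0, le_rfl, 1, one_pos, by simp⟩ ?_ ?_ ?_
    · rintro S T hST ⟨L, hL, r, hr, h⟩
      exact ⟨L, hL, r, hr, fun ω hω => h ω (hST hω)⟩
    · rintro S T ⟨L, hL, r, hr, h⟩ ⟨L', hL', r', hr', h'⟩
      refine ⟨max L L', hL.trans (le_max_left _ _), min r r', lt_min hr hr', ?_⟩
      rintro ω (hω | hω) z₁ hz₁ z₂ hz₂
      · refine (h ω hω z₁ (Metric.ball_subset_ball (min_le_left _ _) hz₁) z₂
          (Metric.ball_subset_ball (min_le_left _ _) hz₂)).trans ?_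
        gcongr
        exact le_max_left _ _
      · refine (h' ω hω z₁ (Metric.ball_subset_ball (min_le_right _ _) hz₁) z₂
          (Metric.ball_subset_ball (min_le_right _ _) hz₂)).trans ?_
        gcongr
        exact le_max_right _ _
    · intro ω _
      obtain ⟨r, hr, V, hV, h⟩ :=
        exists_uniform_strict_differentiability hO hxO hf_diff hf_grad ω one_pos
      refine ⟨V, mem_nhdsWithin_of_mem_nhds hV, 1 + ‖gradient (fun z => f z ω) x‖,
        by positivity, r, hr, fun ω' hω' z₁ hz₁ z₂ hz₂ => ?_⟩
      have h2 := (abs_le.1 (h ω' hω' z₁ hz₁ z₂ hz₂)).2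
      have h3 := real_inner_le_norm (gradient (fun z => f z ω) x) (z₁ - z₂)
      linarith
  obtain ⟨L, hL, r, hr, h⟩ := h1
  obtain ⟨s, hs, hball⟩ := Metric.mem_nhds_iff.1 (hO.mem_nhds hxO)
  refine ⟨L, hL, min r s, lt_min hr hs, fun z₁ hz₁ z₂ hz₂ => ciSup_le fun ω => ?_⟩
  refine (h ω (mem_univ ω) z₁ (Metric.ball_subset_ball (min_le_left _ _) hz₁) z₂
    (Metric.ball_subset_ball (min_le_left _ _) hz₂)).trans ?_
  have := le_maxFun hf_cont (hball (Metric.ball_subset_ball (min_le_right r s) hz₂)) ω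
  linarith

/-- Danskin's theorem: the Hadamard directional derivative of a maximum function. -/
theorem hasHadamardDirDeriv_maxFun [CompleteSpace E] [Nonempty W] (hO : IsOpen O) (hxO : x ∈ O)
    (hf_cont : ContinuousOn (fun p : E × W => f p.1 p.2) (O ×ˢ univ))
    (hf_diff : ∀ z ∈ O, ∀ ω : W, DifferentiableAt ℝ (fun z => f z ω) z)
    (hf_grad : ContinuousOn (fun p : E × W => gradient (fun z => f z p.2) p.1) (O ×ˢ univ))
    {h : E} {m : ℝ} (hm : IsGreatest
      ((fun ω : W => inner ℝ (gradient (fun z => f z ω) x) h) '' activeSet f x) m) :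
    HasHadamardDirDeriv (maxFun f) x h m := by
  have hz := tendsto_add_smul_hadamard x h
  have hpos := eventually_pos_hadamard h
  have hsnd : Tendsto (fun p : ℝ × E => p.2) (𝓝[>] 0 ×ˢ 𝓝 h) (𝓝 h) := tendsto_snd
  have hfst : Tendsto (fun p : ℝ × E => p.1) (𝓝[>] 0 ×ˢ 𝓝 h) (𝓝 0) :=
    (tendsto_nhdsWithin_iff.1 tendsto_fst).1
  have hbd : ∀ᶠ p : ℝ × E in 𝓝[>] 0 ×ˢ 𝓝 h, ‖p.2‖ < ‖h‖ + 1 :=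
    hsnd.norm.eventually_lt_const (lt_add_one _)
  have hin : ∀ v : E, Tendsto (fun p : ℝ × E => (inner ℝ v p.2 : ℝ)) (𝓝[>] 0 ×ˢ 𝓝 h)
      (𝓝 (inner ℝ v h)) := fun v => tendsto_const_nhds.inner hsnd
  have hN : 0 < ‖h‖ + 1 := by positivity
  refine tendsto_order.2 ⟨fun a ha => ?_, fun b hb => ?_⟩
  · obtain ⟨ω, hω, rfl⟩ := hm.1
    simp only at ha
    set v := gradient (fun z => f z ω) x with hv
    -- Chosen so that the linearisation error `ε * ‖h'‖` is at most half the gap while `‖h'‖ < ‖h‖ +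
    -- 1`.
    set ε := (inner ℝ v h - a) / 2 / (‖h‖ + 1) with hε
    have hε0 : 0 < ε := div_pos (half_pos (sub_pos.2 ha)) hN
    obtain ⟨r, hr, V, hV, hd⟩ :=
      exists_uniform_strict_differentiability hO hxO hf_diff hf_grad ω hε0
    have hlow : (inner ℝ v h + a) / 2 < inner ℝ v h := by linarith
    filter_upwards [hz (Metric.ball_mem_nhds x hr), hz (hO.mem_nhds hxO), hpos, hbd,
      (hin v).eventually_const_lt hlow] with p hp hpO hp0 hpb hpi
    have h1 := (abs_le.1 (hd ω (mem_of_mem_nhds hV) _ hp x (Metric.mem_ball_self hr))).1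
    rw [add_sub_cancel_left, norm_smul, Real.norm_of_nonneg hp0.le, inner_smul_right] at h1
    have h2 := le_maxFun hf_cont hpO ω
    have h3 : f x ω = maxFun f x := hω
    have h4 : ε * ‖p.2‖ ≤ (inner ℝ v h - a) / 2 := by
      calc ε * ‖p.2‖ ≤ ε * (‖h‖ + 1) := mul_le_mul_of_nonneg_left hpb.le hε0.le
        _ = _ := div_mul_cancel₀ _ hN.ne'
    rw [lt_div_iff₀ hp0]
    have h5 : a * p.1 < (inner ℝ v p.2 - ε * ‖p.2‖) * p.1 :=
      mul_lt_mul_of_pos_right (by linarith) hp0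
    linarith
  -- The maximising index at the moved point is unknown, so the upper estimate must be uniform in
  -- `ω`.
  · have key : ∀ᶠ p : ℝ × E in 𝓝[>] 0 ×ˢ 𝓝 h, ∀ ω ∈ (univ : Set W),
        f (x + p.1 • p.2) ω < maxFun f x + b * p.1 := by
      refine isCompact_univ.induction_on (p := fun S => ∀ᶠ p : ℝ × E in 𝓝[>] 0 ×ˢ 𝓝 h,
        ∀ ω ∈ S, f (x + p.1 • p.2) ω < maxFun f x + b * p.1) (by simp) ?_ ?_ ?_
      · exact fun S T hST hT => hT.mono fun p hp ω hω => hp ω (hST hω)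
      · intro S T hS hT
        filter_upwards [hS, hT] with p h1 h2 ω hω
        exact hω.elim (h1 ω) (h2 ω)
      · intro ω _
        by_cases hω : f x ω = maxFun f x
        · set v := gradient (fun z => f z ω) x with hv
          have hvb : inner ℝ v h < b := (hm.2 ⟨ω, hω, rfl⟩).trans_lt hb
          set ε := (b - inner ℝ v h) / 2 / (‖h‖ + 1) with hε
          have hε0 : 0 < ε := div_pos (half_pos (sub_pos.2 hvb)) hN
          obtain ⟨r, hr, V, hV, hd⟩ :=
            exists_uniform_strict_differentiability hO hxO hf_diff hf_grad ω hε0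
          have hup : inner ℝ v h < (inner ℝ v h + b) / 2 := by linarith
          refine ⟨V, mem_nhdsWithin_of_mem_nhds hV, ?_⟩
          filter_upwards [hz (Metric.ball_mem_nhds x hr), hpos, hbd,
            (hin v).eventually_lt_const hup] with p hp hp0 hpb hpi ω' hω'
          have h1 := (abs_le.1 (hd ω' hω' _ hp x (Metric.mem_ball_self hr))).2
          rw [add_sub_cancel_left, norm_smul, Real.norm_of_nonneg hp0.le,
            inner_smul_right] at h1
          have h2 := le_maxFun hf_cont hxO ω'
          have h4 : ε * ‖p.2‖ ≤ (b - inner ℝ v h) / 2 := by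
            calc ε * ‖p.2‖ ≤ ε * (‖h‖ + 1) := mul_le_mul_of_nonneg_left hpb.le hε0.le
              _ = _ := div_mul_cancel₀ _ hN.ne'
          have h5 : (inner ℝ v p.2 + ε * ‖p.2‖) * p.1 < b * p.1 :=
            mul_lt_mul_of_pos_right (by linarith) hp0
          linarith
        -- Near an inactive index `f` stays below `F(x)` by a fixed margin, which dominates `b * α`
        -- as `α → 0`.
        · have hlt : f x ω < maxFun f x := lt_of_le_of_ne (le_maxFun hf_cont hxO ω) hω
          have hc := hf_cont.continuousAt (x := (x, ω))
            ((hO.prod isOpen_univ).mem_nhds ⟨hxO, mem_univ ω⟩)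
          have h1 := hc.eventually_lt_const
            (show f x ω < (f x ω + maxFun f x) / 2 by linarith)
          rw [nhds_prod_eq, eventually_prod_iff] at h1
          obtain ⟨P, hP, Q, hQ, hPQ⟩ := h1
          refine ⟨{ω | Q ω}, mem_nhdsWithin_of_mem_nhds hQ, ?_⟩
          have h2 : Tendsto (fun p : ℝ × E => b * p.1) (𝓝[>] 0 ×ˢ 𝓝 h) (𝓝 0) := by
            simpa using hfst.const_mul b
          filter_upwards [hz.eventually hP, h2.eventually_const_lt
            (show (f x ω - maxFun f x) / 2 < 0 by linarith)] with p hp hpb ω' hω'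
          have h3 : f (x + p.1 • p.2) ω' < (f x ω + maxFun f x) / 2 := hPQ hp hω'
          linarith
    filter_upwards [key, hz (hO.mem_nhds hxO), hpos] with p hp hpO hp0
    obtain ⟨ω, hω⟩ := exists_eq_maxFun hf_cont hpO
    rw [div_lt_iff₀ hp0]
    have := hp ω (mem_univ ω)
    rw [hω] at this
    linarith

end MaxFunction

/-! ### Hadamard derivative of the distance to the constraint cone. -/

section Distance

variable {E : Type*} [NormedAddCommGroup E] [InnerProductSpace ℝ E]
  {Y : Type*} [NormedAddCommGroup Y] [NormedSpace ℝ Y]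

theorem HasFDerivAt.tendsto_hadamard {G : E → Y} {x : E} {D : E →L[ℝ] Y}
    (hG : HasFDerivAt G D x) (h : E) :
    Tendsto (fun p : ℝ × E => p.1⁻¹ • (G (x + p.1 • p.2) - G x)) (𝓝[>] 0 ×ˢ 𝓝 h)
      (𝓝 (D h)) := by
  have hfst : Tendsto (fun p : ℝ × E => p.1) (𝓝[>] 0 ×ˢ 𝓝 h) (𝓝[>] 0) := tendsto_fst
  have hsnd : Tendsto (fun p : ℝ × E => p.2) (𝓝[>] 0 ×ˢ 𝓝 h) (𝓝 h) := tendsto_snd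
  refine (hasFDerivWithinAt_univ.2 hG).lim ?_ (Eventually.of_forall fun _ => mem_univ _) ?_
  · simpa using (tendsto_nhdsWithin_iff.1 hfst).1.smul hsnd
  · refine hsnd.congr' ?_
    filter_upwards [eventually_pos_hadamard h] with p hp
    rw [inv_smul_smul₀ hp.ne']

/-- From below, `K - G x` lies in the contingent cone, so the quotient dominates the distance from
the difference quotient of `G` to that cone. From above, a feasible direction `u` nearly realising
the distance satisfies `G x + α • u ∈ K` for all small `α`. -/
theorem hasHadamardDirDeriv_infDist_comp {G : E → Y} {x : E} {D : E →L[ℝ] Y}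
    (hG : HasFDerivAt G D x) {K : Set Y} (hK : Convex ℝ K) (hx : G x ∈ K) (h : E) :
    HasHadamardDirDeriv (fun z => Metric.infDist (G z) K) x h
      (Metric.infDist (D h) (contingentCone K (G x))) := by
  have hlim := HasFDerivAt.tendsto_hadamard hG h
  have hpos := eventually_pos_hadamard h
  have hfst : Tendsto (fun p : ℝ × E => p.1) (𝓝[>] 0 ×ˢ 𝓝 h) (𝓝 0) :=
    (tendsto_nhdsWithin_iff.1 tendsto_fst).1
  refine tendsto_order.2 ⟨fun a ha => ?_, fun b hb => ?_⟩
  · have h1 := ((Metric.continuous_infDist_pt (contingentCone K (G x))).tendsto (D h)).comp hlim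
    filter_upwards [h1.eventually_const_lt ha, hpos] with p hp hp0
    refine hp.trans_le ?_
    rw [Metric.infDist_zero_of_mem hx, sub_zero, le_div_iff₀ hp0,
      Metric.le_infDist ⟨_, hx⟩]
    intro k hk
    have h2 := Metric.infDist_le_dist_of_mem (x := p.1⁻¹ • (G (x + p.1 • p.2) - G x))
      (sub_mem_contingentCone hK hx hk (inv_pos.2 hp0))
    rw [dist_smul₀, dist_sub_right, norm_inv, Real.norm_of_nonneg hp0.le, inv_mul_eq_div,
      le_div_iff₀ hp0] at h2
    exact h2
  · rw [contingentCone_eq_closure hK hx, Metric.infDist_closure, gt_iff_lt,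
      Metric.infDist_lt_iff (show {u | ∃ t : ℝ, 0 < t ∧ G x + t • u ∈ K}.Nonempty from
        ⟨0, 1, one_pos, by simpa using hx⟩)] at hb
    obtain ⟨u, ⟨t, ht, hut⟩, hub⟩ := hb
    filter_upwards [(hlim.dist tendsto_const_nhds).eventually_lt_const hub, hpos,
      hfst.eventually_lt_const ht] with p hp hp0 hpt
    rw [Metric.infDist_zero_of_mem hx, sub_zero, div_lt_iff₀ hp0]
    refine (Metric.infDist_le_dist_of_mem
      (Convex.add_smul_mem_of_le hK hx hp0.le hpt.le hut)).trans_lt ?_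
    have h2 : dist (G (x + p.1 • p.2)) (G x + p.1 • u) =
        p.1 * dist (p.1⁻¹ • (G (x + p.1 • p.2) - G x)) u := by
      rw [dist_eq_norm, dist_eq_norm]
      conv_rhs => rw [← Real.norm_of_nonneg hp0.le, ← norm_smul, smul_sub,
        Real.norm_of_nonneg hp0.le, smul_inv_smul₀ hp0.ne', sub_sub]
    rw [h2, mul_comm b]
    exact mul_lt_mul_of_pos_left hp hp0

theorem HasHadamardDirDeriv.add_const_mul {φ ψ : E → ℝ} {x h : E} {a b : ℝ}
    (hφ : HasHadamardDirDeriv φ x h a) (hψ : HasHadamardDirDeriv ψ x h b) (c : ℝ) :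
    HasHadamardDirDeriv (fun z => φ z + c * ψ z) x h (a + c * b) := by
  have h1 := Tendsto.add hφ (Tendsto.const_mul c hψ)
  refine h1.congr fun p => ?_
  ring

theorem HasHadamardDirDeriv.hasDirDeriv {φ : E → ℝ} {x h : E} {a : ℝ}
    (hφ : HasHadamardDirDeriv φ x h a) : HasDirDeriv φ x h a := by
  have h1 := (tendsto_id (x := 𝓝[>] (0 : ℝ))).prodMk
    (tendsto_const_nhds (x := h) (f := 𝓝[>] (0 : ℝ)))
  have h2 := Tendsto.comp hφ h1
  exact h2

theorem hasHadamardDirDeriv_clm_comp {G : E → Y} {x : E} {D : E →L[ℝ] Y}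
    (hG : HasFDerivAt G D x) (l : StrongDual ℝ Y) (h : E) :
    HasHadamardDirDeriv (fun z => l (G z)) x h (l (D h)) := by
  have h1 := (l.continuous.tendsto (D h)).comp (HasFDerivAt.tendsto_hadamard hG h)
  refine h1.congr fun p => ?_
  simp only [Function.comp_apply, map_smul, map_sub, smul_eq_mul]
  rw [inv_mul_eq_div]

end Distance

/-! ### Robinson's condition and the error bound. -/

section Robinson

variable {E : Type*} [NormedAddCommGroup E] [NormedSpace ℝ E]
  {Y : Type*} [NormedAddCommGroup Y] [NormedSpace ℝ Y]

/-- The values at which the constraint linearised at `x` is solvable within distance `R`. -/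
def linearizedRange (A : Set E) (K : Set Y) (D : E →L[ℝ] Y) (x : E) (y : Y) (R : ℝ) : Set Y :=
  {e | ∃ a ∈ A, ‖a - x‖ ≤ R ∧ ∃ k ∈ K, e = y + D (a - x) - k}

variable {A : Set E} {K : Set Y} {D : E →L[ℝ] Y} {x : E} {y : Y}

/-- Finite dimension and the radius bound make the image of `A` compact, and compact plus closed is
closed. This is the closedness used in the Baire argument. -/
theorem isClosed_linearizedRange [FiniteDimensional ℝ E] (hA : IsClosed A) (hK : IsClosed K) (R : ℝ) :
    IsClosed (linearizedRange A K D x y R) := by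
  have := FiniteDimensional.proper_real E
  have hc : IsCompact ((fun a => y + D (a - x)) '' (A ∩ Metric.closedBall x R)) :=
    ((isCompact_closedBall x R).inter_left hA).image (by fun_prop)
  convert hK.neg.add_left_of_isCompact hc using 1
  ext e
  constructor
  · rintro ⟨a, ha, hR, k, hk, rfl⟩
    exact ⟨_, ⟨a, ⟨ha, mem_closedBall_iff_norm.2 hR⟩, rfl⟩, -k, by simpa using hk,
      (sub_eq_add_neg _ _).symm⟩
  · rintro ⟨_, ⟨a, ⟨ha, hR⟩, rfl⟩, k, hk, rfl⟩
    exact ⟨a, ha, mem_closedBall_iff_norm.1 hR, -k, hk, by simp⟩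

theorem convex_linearizedRange (hA : Convex ℝ A) (hK : Convex ℝ K) (R : ℝ) :
    Convex ℝ (linearizedRange A K D x y R) := by
  rintro _ ⟨a, ha, haR, k, hk, rfl⟩ _ ⟨b, hb, hbR, l, hl, rfl⟩ s t hs ht hst
  have hx : s • a + t • b - x = s • (a - x) + t • (b - x) := by
    calc s • a + t • b - x = s • a + t • b - (s + t) • x := by rw [hst, one_smul]
      _ = _ := by module
  refine ⟨s • a + t • b, hA ha hb hs ht hst, ?_, s • k + t • l, hK hk hl hs ht hst, ?_⟩
  · rw [hx]
    refine (norm_add_le _ _).trans ?_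
    rw [norm_smul, norm_smul, Real.norm_of_nonneg hs, Real.norm_of_nonneg ht]
    calc s * ‖a - x‖ + t * ‖b - x‖ ≤ s * R + t * R := by gcongr
      _ = R := by rw [← add_mul, hst, one_mul]
  · rw [hx, map_add, map_smul, map_smul]
    calc _ = (s + t) • y + (s • D (a - x) + t • D (b - x)) - (s • k + t • l) := by module
      _ = _ := by rw [hst, one_smul]

theorem linearizedRange_mono {R S : ℝ} (h : R ≤ S) :
    linearizedRange A K D x y R ⊆ linearizedRange A K D x y S := by
  rintro _ ⟨a, ha, haR, hk⟩
  exact ⟨a, ha, haR.trans h, hk⟩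

theorem smul_mem_linearizedRange_one (hA : Convex ℝ A) (hK : Convex ℝ K) (hx : x ∈ A)
    (hy : y ∈ K) {R : ℝ} (hR : 1 ≤ R) {e : Y} (he : e ∈ linearizedRange A K D x y R) :
    R⁻¹ • e ∈ linearizedRange A K D x y 1 := by
  obtain ⟨a, ha, haR, k, hk, rfl⟩ := he
  have hR0 : 0 < R := one_pos.trans_le hR
  have hmem : R⁻¹ ∈ Icc (0 : ℝ) 1 := ⟨inv_nonneg.2 hR0.le, inv_le_one_of_one_le₀ hR⟩
  refine ⟨x + R⁻¹ • (a - x), hA.add_smul_sub_mem hx ha hmem, ?_,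
    y + R⁻¹ • (k - y), hK.add_smul_sub_mem hy hk hmem, ?_⟩
  · rw [add_sub_cancel_left, norm_smul, norm_inv, Real.norm_of_nonneg hR0.le,
      inv_mul_le_iff₀ hR0, mul_one]
    exact haR
  · rw [add_sub_cancel_left, map_smul]
    module

/-- Under Robinson's condition the linearised constraint can be solved boundedly. -/
theorem exists_ball_subset_linearizedRange [FiniteDimensional ℝ E] [CompleteSpace Y]
    (hAc : IsClosed A) (hA : Convex ℝ A) (hKc : IsClosed K) (hK : Convex ℝ K) (hx : x ∈ A) (hy : y ∈ K)
    (h : (0 : Y) ∈ interior {e | ∃ a ∈ A, ∃ k ∈ K, e = y + D (a - x) - k}) :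
    ∃ η > 0, ∀ e : Y, ‖e‖ ≤ η → e ∈ linearizedRange A K D x y 1 := by
  rw [mem_interior_iff_mem_nhds] at h
  have hscale : ∀ e : Y, Tendsto (fun t : ℝ => t • e) (𝓝[>] 0) (𝓝 0) := by
    intro e
    have h1 : Tendsto (fun t : ℝ => t • e) (𝓝 0) (𝓝 ((0 : ℝ) • e)) :=
      (continuous_id.smul continuous_const).tendsto 0
    rw [zero_smul] at h1
    exact h1.mono_left nhdsWithin_le_nhds
  have hmem : ∀ e ∈ {e | ∃ a ∈ A, ∃ k ∈ K, e = y + D (a - x) - k},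
      ∃ n : ℕ, e ∈ linearizedRange A K D x y n := by
    rintro e ⟨a, ha, k, hk, rfl⟩
    obtain ⟨n, hn⟩ := exists_nat_ge ‖a - x‖
    exact ⟨n, a, ha, hn, k, hk, rfl⟩
  -- Baire category: Robinson's condition only covers a neighbourhood of `0`, so a scaling index `m`
  -- accompanies the radius `n` to cover all of `Y`.
  obtain ⟨⟨m, n⟩, v, hv⟩ := nonempty_interior_of_iUnion_of_closed
    (f := fun p : ℕ × ℕ => {e : Y | ((p.1 : ℝ) + 1)⁻¹ • e ∈ linearizedRange A K D x y p.2})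
    (fun p => (isClosed_linearizedRange hAc hKc _).preimage (continuous_const_smul _)) (by
      refine eq_univ_of_forall fun e => mem_iUnion.2 ?_
      have h1 : Tendsto (fun m : ℕ => ((m : ℝ) + 1)⁻¹) atTop (𝓝[>] 0) :=
        tendsto_nhdsWithin_iff.2 ⟨by simpa using tendsto_one_div_add_atTop_nhds_zero_nat (𝕜 := ℝ),
          Eventually.of_forall fun n => mem_Ioi.2 (by positivity)⟩
      obtain ⟨m, hm⟩ := (((hscale e).comp h1).eventually h).exists
      obtain ⟨n, hn⟩ := hmem _ hm
      exact ⟨(m, n), hn⟩)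
  have hm0 : ((m : ℝ) + 1)⁻¹ ≠ 0 := by positivity
  set u := ((m : ℝ) + 1)⁻¹ • v with hu
  have hui : u ∈ interior (linearizedRange A K D x y n) := by
    have h1 : v ∈ interior ((fun e : Y => ((m : ℝ) + 1)⁻¹ • e) ⁻¹'
      linearizedRange A K D x y n) := hv
    rw [← (isOpenMap_smul₀ hm0).preimage_interior_eq_interior_preimage
      (continuous_const_smul _)] at h1
    exact h1
  -- With `u` interior and `-t • u` also attained, `0` lies on the open segment between them and is
  -- therefore interior.
  obtain ⟨t, hts, ht0⟩ := (((hscale (-u)).eventually h).and self_mem_nhdsWithin).exists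
  obtain ⟨n', hn'⟩ := hmem _ hts
  have ht0 : 0 < t := ht0
  set R : ℝ := max 1 (max n n') with hR
  have hR1 : 1 ≤ R := le_max_left _ _
  have h0 : (0 : Y) ∈ interior (linearizedRange A K D x y R) := by
    refine (convex_linearizedRange hA hK R).openSegment_interior_self_subset_interior
      (interior_mono (linearizedRange_mono ((le_max_left _ _).trans (le_max_right _ _))) hui)
      (linearizedRange_mono ((le_max_right _ _).trans (le_max_right _ _)) hn') ?_
    refine ⟨t / (1 + t), 1 / (1 + t), by positivity, by positivity, by field_simp; ring, ?_⟩
    module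
  obtain ⟨δ, hδ, hball⟩ := Metric.mem_nhds_iff.1 (mem_interior_iff_mem_nhds.1 h0)
  have hR0 : 0 < R := one_pos.trans_le hR1
  refine ⟨δ / 2 / R, by positivity, fun e he => ?_⟩
  have h1 : R • e ∈ linearizedRange A K D x y R := by
    refine hball (mem_ball_zero_iff.2 ?_)
    rw [norm_smul, Real.norm_of_nonneg hR0.le]
    rw [le_div_iff₀ hR0] at he
    linarith
  have h2 := smul_mem_linearizedRange_one hA hK hx hy hR1 h1
  rwa [inv_smul_smul₀ hR0.ne'] at h2

/-- Descent of the constraint violation at infeasible points close to `x`. -/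
theorem exists_infDist_descent (hA : Convex ℝ A) (hK : Convex ℝ K) (hKne : K.Nonempty)
    {G : E → Y} {η r : ℝ} (hη : 0 < η)
    (hlin : ∀ e : Y, ‖e‖ ≤ η → e ∈ linearizedRange A K D x (G x) 1) (hr : r ≤ 1)
    (hG : ∀ z₁ ∈ Metric.ball x r, ∀ z₂ ∈ Metric.ball x r,
      ‖G z₁ - G z₂ - D (z₁ - z₂)‖ ≤ η / 16 * ‖z₁ - z₂‖)
    {z : E} (hz : z ∈ A) (hzr : z ∈ Metric.ball x r) (hpos : 0 < Metric.infDist (G z) K)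
    {δ : ℝ} (hδ : 0 < δ) :
    ∃ z' ∈ A, ‖z' - z‖ < δ ∧
      Metric.infDist (G z') K + η / 8 * ‖z' - z‖ < Metric.infDist (G z) K := by
  set ψ := Metric.infDist (G z) K with hψ
  have hzx : ‖z - x‖ < r := mem_ball_iff_norm.1 hzr
  have hrpos : 0 < r := (norm_nonneg _).trans_lt hzx
  -- The condition `t * η ≤ (1 - t) * ψ` keeps the residual coefficient `1 - t - t * (η / s)`
  -- nonnegative; the last two keep the step short and inside the ball.
  obtain ⟨t, ht0, ht1, htη, htδ, htr⟩ : ∃ t : ℝ, 0 < t ∧ t < 1 ∧ t * η ≤ (1 - t) * ψ ∧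
      2 * t < δ ∧ 2 * t < r - ‖z - x‖ := by
    have hev : ∀ᶠ t : ℝ in 𝓝[>] 0, t < 1 ∧ t * η < (1 - t) * ψ ∧ 2 * t < δ ∧
        2 * t < r - ‖z - x‖ := by
      refine nhdsWithin_le_nhds ?_
      refine ((continuous_id.tendsto (0 : ℝ)).eventually_lt_const one_pos).and
        (((?_ : ContinuousAt (fun t : ℝ => t * η) 0).eventually_lt
          (?_ : ContinuousAt (fun t : ℝ => (1 - t) * ψ) 0) (by simpa using hpos)).and
        (((?_ : ContinuousAt (fun t : ℝ => 2 * t) 0).eventually_lt_const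
          (by simpa using hδ)).and
        ((?_ : ContinuousAt (fun t : ℝ => 2 * t) 0).eventually_lt_const
          (by simpa using hzx))))
      all_goals fun_prop
    obtain ⟨t, ⟨h1, h2, h3, h4⟩, h0⟩ := (hev.and self_mem_nhdsWithin).exists
    exact ⟨t, h0, h1, h2.le, h3, h4⟩
  obtain ⟨k, hk, hkd⟩ := (Metric.infDist_lt_iff hKne).1
    (lt_add_of_pos_right ψ (by positivity : 0 < t * (η / 4)))
  have hψk : ψ ≤ dist (G z) k := Metric.infDist_le_dist_of_mem hk
  rw [dist_eq_norm] at hkd hψk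
  set s := ‖G z - k‖ with hs
  have hs0 : 0 < s := hpos.trans_le hψk
  -- The linearised system is solved for a vector of norm `η` opposite to the residual `G z - k`.
  -- Moving from `z` towards `a` and from `k` towards `k'` by the fraction `t` then cuts the
  -- residual by at least `t * η`, up to linearisation errors.
  obtain ⟨a, ha, hax, k', hk', he⟩ := hlin (-(η / s) • (G z - k)) (by
    rw [norm_smul, norm_neg, Real.norm_of_nonneg (by positivity), ← hs, div_mul_cancel₀ _ hs0.ne'])
  have haz : ‖a - z‖ ≤ 2 := by
    calc ‖a - z‖ = ‖(a - x) - (z - x)‖ := by rw [sub_sub_sub_cancel_right]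
      _ ≤ ‖a - x‖ + ‖z - x‖ := norm_sub_le _ _
      _ ≤ 2 := by linarith
  have hIcc : t ∈ Icc (0 : ℝ) 1 := ⟨ht0.le, ht1.le⟩
  have hdist : ‖z + t • (a - z) - z‖ = t * ‖a - z‖ := by
    rw [add_sub_cancel_left, norm_smul, Real.norm_of_nonneg ht0.le]
  have htaz : t * ‖a - z‖ ≤ 2 * t := by
    rw [mul_comm 2 t]; exact mul_le_mul_of_nonneg_left haz ht0.le
  have hz'r : z + t • (a - z) ∈ Metric.ball x r := by
    rw [mem_ball_iff_norm]
    calc ‖z + t • (a - z) - x‖ = ‖(z + t • (a - z) - z) + (z - x)‖ := by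
          rw [sub_add_sub_cancel]
      _ ≤ t * ‖a - z‖ + ‖z - x‖ := by rw [← hdist]; exact norm_add_le _ _
      _ < r := by linarith
  have hle : Metric.infDist (G (z + t • (a - z))) K ≤
      η / 16 * (t * ‖a - z‖) + (s - t * η) + t * (η / 16) := by
    refine (Metric.infDist_le_dist_of_mem (hK.add_smul_sub_mem hk hk' hIcc)).trans ?_
    -- Three terms: the remainder along the step, the contracted residual, and the error of
    -- linearising at `x` instead of at `z`.
    have hdec : G (z + t • (a - z)) - (k + t • (k' - k)) =
        (G (z + t • (a - z)) - G z - D (z + t • (a - z) - z)) +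
        (1 - t - t * (η / s)) • (G z - k) + t • (G z - G x - D (z - x)) := by
      have h1 : D (a - z) = D (a - x) - D (z - x) := by
        rw [← map_sub, sub_sub_sub_cancel_right]
      have h2 : k' = G x + D (a - x) - (-(η / s) • (G z - k)) := by rw [he]; abel
      rw [add_sub_cancel_left, map_smul, h1, h2]
      module
    rw [dist_eq_norm, hdec]
    refine (norm_add₃_le).trans ?_
    have h1 := hG _ hz'r z hzr
    rw [hdist] at h1
    have h2 : ‖(1 - t - t * (η / s)) • (G z - k)‖ ≤ s - t * η := by
      have h3 : (1 - t - t * (η / s)) * s = (1 - t) * s - t * η := by field_simp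
      have h4 : (1 - t) * ψ ≤ (1 - t) * s := mul_le_mul_of_nonneg_left hψk (by linarith)
      have h5 : 0 ≤ 1 - t - t * (η / s) := by
        refine nonneg_of_mul_nonneg_left ?_ hs0
        rw [h3]; linarith
      rw [norm_smul, Real.norm_of_nonneg h5, ← hs, h3]
      nlinarith
    have h6 : ‖t • (G z - G x - D (z - x))‖ ≤ t * (η / 16) := by
      rw [norm_smul, Real.norm_of_nonneg ht0.le]
      refine mul_le_mul_of_nonneg_left ?_ ht0.le
      refine (hG z hzr x (Metric.mem_ball_self hrpos)).trans ?_
      exact mul_le_of_le_one_right (by positivity) (by linarith)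
    linarith
  refine ⟨z + t • (a - z), hA.add_smul_sub_mem hz ha hIcc, ?_, ?_⟩
  · rw [hdist]; linarith
  · rw [hdist]
    -- In units of `t * η`, the inexact choice of `k` costs 1/4, the two remainders 1/8 and 1/16,
    -- and the demanded decrease 1/4: in total 11/16, below the gain 1.
    have h1 := mul_le_mul_of_nonneg_left htaz hη.le
    have h2 : 0 < t * η := by positivity
    linarith

/-- Robinson's error bound for the constraint `z ∈ A`, `G z ∈ K`. -/
theorem exists_error_bound [FiniteDimensional ℝ E] [CompleteSpace Y] (hAc : IsClosed A)
    (hA : Convex ℝ A)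
    (hKc : IsClosed K) (hK : Convex ℝ K) {G : E → Y} (hx : x ∈ A) (hGx : G x ∈ K)
    {O : Set E} (hO : O ∈ 𝓝 x) (hGc : ContinuousOn G O) (hG : HasStrictFDerivAt G D x)
    (h : (0 : Y) ∈ interior {e | ∃ a ∈ A, ∃ k ∈ K, e = G x + D (a - x) - k}) :
    ∃ κ > 0, ∀ᶠ z₀ in 𝓝 x, z₀ ∈ A →
      ∃ z ∈ A, G z ∈ K ∧ κ * ‖z - z₀‖ ≤ Metric.infDist (G z₀) K := by
  obtain ⟨η, hη, hlin⟩ := exists_ball_subset_linearizedRange hAc hA hKc hK hx hGx h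
  have hst := hG.isLittleO.def (by positivity : 0 < η / 16)
  rw [nhds_prod_eq] at hst
  obtain ⟨U, hU, hUU⟩ := mem_prod_self_iff.1 hst
  obtain ⟨r', hr', hball⟩ := Metric.mem_nhds_iff.1 (inter_mem hU hO)
  set r := min r' 1 with hr
  have hr0 : 0 < r := lt_min hr' one_pos
  have hsub : Metric.ball x r ⊆ U ∩ O := (Metric.ball_subset_ball (min_le_left _ _)).trans hball
  have hGr : ∀ z₁ ∈ Metric.ball x r, ∀ z₂ ∈ Metric.ball x r,
      ‖G z₁ - G z₂ - D (z₁ - z₂)‖ ≤ η / 16 * ‖z₁ - z₂‖ := fun z₁ h₁ z₂ h₂ =>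
    hUU (mk_mem_prod (hsub h₁).1 (hsub h₂).1)
  have hψ : ContinuousOn (fun z => Metric.infDist (G z) K) O :=
    (Metric.continuous_infDist_pt K).comp_continuousOn hGc
  have hψ0 : ∀ᶠ z in 𝓝 x, Metric.infDist (G z) K < η / 8 * (r / 8) := by
    refine (hψ.continuousAt hO).eventually_lt_const ?_
    simp only [Metric.infDist_zero_of_mem hGx]
    positivity
  refine ⟨η / 8, by positivity, ?_⟩
  filter_upwards [hψ0, Metric.ball_mem_nhds x (by positivity : 0 < r / 8)] with z₀ hz₀ hz₀r hz₀A
  rw [mem_ball_iff_norm] at hz₀r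
  have := FiniteDimensional.proper_real E
  have hcb : Metric.closedBall x (r / 2) ⊆ Metric.ball x r :=
    Metric.closedBall_subset_ball (by linarith)
  have hz₀m : z₀ ∈ A ∩ Metric.closedBall x (r / 2) :=
    ⟨hz₀A, mem_closedBall_iff_norm.2 (by linarith)⟩
  -- A compactness substitute for Ekeland's principle: an infeasible minimiser would be contradicted
  -- by the descent step at rate `η / 8`.
  obtain ⟨z, hz, hmin⟩ := ((isCompact_closedBall x (r / 2)).inter_left hAc).exists_isMinOn
    ⟨z₀, hz₀m⟩ (f := fun z => Metric.infDist (G z) K + η / 8 * ‖z - z₀‖)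
    ((hψ.mono fun z hz => (hsub (hcb hz.2)).2).add (by fun_prop))
  have hle : Metric.infDist (G z) K + η / 8 * ‖z - z₀‖ ≤ Metric.infDist (G z₀) K := by
    simpa using hmin hz₀m
  have hle' : η / 8 * ‖z - z₀‖ ≤ Metric.infDist (G z₀) K := by
    linarith [Metric.infDist_nonneg (x := G z) (s := K)]
  refine ⟨z, hz.1, ?_, hle'⟩
  rw [hKc.mem_iff_infDist_zero ⟨_, hGx⟩]
  by_contra hne
  obtain ⟨z', hz'A, hz'z, hlt⟩ := exists_infDist_descent hA hK ⟨_, hGx⟩ hη hlin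
    (min_le_right _ _) hGr hz.1 (hcb hz.2)
    (lt_of_le_of_ne Metric.infDist_nonneg (Ne.symm hne)) (by positivity : 0 < r / 4)
  have hzz₀ : ‖z - z₀‖ < r / 8 :=
    lt_of_mul_lt_mul_left (hle'.trans_lt hz₀) (by positivity)
  -- The distances `r / 4`, `r / 8` and `r / 8` add up to `r / 2`, so `z'` competes in the same
  -- minimisation.
  have hz'm : z' ∈ A ∩ Metric.closedBall x (r / 2) := by
    refine ⟨hz'A, mem_closedBall_iff_norm.2 ?_⟩
    have h1 : z' - x = (z' - z) + (z - z₀) + (z₀ - x) := by abel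
    rw [h1]
    refine norm_add₃_le.trans ?_
    linarith
  have h1 := hmin hz'm
  simp only [mem_ofPred_eq] at h1
  have h2 : ‖z' - z₀‖ ≤ ‖z' - z‖ + ‖z - z₀‖ := norm_sub_le_norm_sub_add_norm_sub _ _ _
  have h3 := mul_le_mul_of_nonneg_left h2 (by positivity : 0 ≤ η / 8)
  linarith

end Robinson

/-! ### Transfer of growth to the penalty function. -/

section Penalty

variable {E : Type*} [NormedAddCommGroup E] {Y : Type*} [NormedAddCommGroup Y]

/-- An error bound turns growth of a Lipschitz function on the feasible set into growth of the
penalty function on `A`. -/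
theorem eventually_penalty_growth {A : Set E} {K : Set Y} {G : E → Y} {F : E → ℝ} {x : E}
    {κ L ρ r : ℝ} (hκ : 0 < κ) (hL : 0 ≤ L) (hρ : 0 ≤ ρ) (hr : 0 < r)
    (herr : ∀ᶠ z₀ in 𝓝 x, z₀ ∈ A →
      ∃ z ∈ A, G z ∈ K ∧ κ * ‖z - z₀‖ ≤ Metric.infDist (G z₀) K)
    (hGx : G x ∈ K) (hGc : ContinuousAt G x)
    (hF : ∀ z₁ ∈ Metric.ball x r, ∀ z₂ ∈ Metric.ball x r, F z₁ ≤ F z₂ + L * ‖z₁ - z₂‖)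
    {U : Set E} (hU : U ∈ 𝓝 x)
    (hgrow : ∀ z ∈ U, z ∈ A → G z ∈ K → F x + ρ * ‖z - x‖ ≤ F z)
    {c : ℝ} (hc : (L + ρ) / κ ≤ c) :
    ∀ᶠ z in 𝓝 x, z ∈ A → F x + ρ * ‖z - x‖ ≤ F z + c * Metric.infDist (G z) K := by
  obtain ⟨s, hs, hball⟩ := Metric.mem_nhds_iff.1 (inter_mem hU (Metric.ball_mem_nhds x hr))
  have hψ0 : ∀ᶠ z in 𝓝 x, Metric.infDist (G z) K < κ * (s / 2) := by
    refine ((Metric.continuous_infDist_pt K).continuousAt.comp hGc).eventually_lt_const ?_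
    rw [Function.comp_apply, Metric.infDist_zero_of_mem hGx]
    positivity
  filter_upwards [herr, hψ0, Metric.ball_mem_nhds x (half_pos hs)] with z₀ h1 h2 h3 hz₀
  obtain ⟨z, hzA, hzK, hz⟩ := h1 hz₀
  rw [mem_ball_iff_norm] at h3
  have h4 : ‖z - z₀‖ < s / 2 := lt_of_mul_lt_mul_left (hz.trans_lt h2) hκ.le
  have h5 : ‖z - x‖ ≤ ‖z - z₀‖ + ‖z₀ - x‖ := norm_sub_le_norm_sub_add_norm_sub _ _ _
  have hzs : z ∈ Metric.ball x s := mem_ball_iff_norm.2 (by linarith)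
  have hz₀s : z₀ ∈ Metric.ball x s := mem_ball_iff_norm.2 (by linarith)
  have h6 := hgrow z (hball hzs).1 hzA hzK
  have h7 := hF z (hball hzs).2 z₀ (hball hz₀s).2
  have h8 : ‖z₀ - x‖ ≤ ‖z - z₀‖ + ‖z - x‖ := by
    rw [norm_sub_rev z z₀]
    exact norm_sub_le_norm_sub_add_norm_sub _ _ _
  have h9 := mul_le_mul_of_nonneg_left h8 hρ
  -- Passing from `z₀` to the feasible `z` costs `L * ‖z - z₀‖` in `F` and `ρ * ‖z - z₀‖` in the
  -- growth term; the penalty pays for both.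
  have h10 : (L + ρ) * ‖z - z₀‖ ≤ c * Metric.infDist (G z₀) K := by
    calc (L + ρ) * ‖z - z₀‖ = (L + ρ) / κ * (κ * ‖z - z₀‖) := by field_simp
      _ ≤ (L + ρ) / κ * Metric.infDist (G z₀) K :=
        mul_le_mul_of_nonneg_left hz (by positivity)
      _ ≤ _ := mul_le_mul_of_nonneg_right hc Metric.infDist_nonneg
  linarith

end Penalty

/-! ### Active gradients and Lagrange multipliers. -/

section OptimalityConditions

variable {E : Type*} [NormedAddCommGroup E] [InnerProductSpace ℝ E]
  {W : Type*} {Y : Type*} [NormedAddCommGroup Y] [NormedSpace ℝ Y]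

/-- The maximum of the active gradients is a sublinear function of the direction. -/
theorem exists_sublinear_isGreatest_gradient [CompleteSpace E] [TopologicalSpace W]
    [CompactSpace W] [Nonempty W] {f : E → W → ℝ} {O : Set E} {x : E} (hxO : x ∈ O)
    (hf_cont : ContinuousOn (fun p : E × W => f p.1 p.2) (O ×ˢ univ))
    (hf_grad : ContinuousOn (fun p : E × W => gradient (fun z => f z p.2) p.1) (O ×ˢ univ)) :
    ∃ (g : E → ℝ) (L : ℝ), IsSublinear g ∧ (∀ h, g h ≤ L * ‖h‖) ∧
      ∀ h, IsGreatest
        ((fun ω : W => inner ℝ (gradient (fun z => f z ω) x) h) '' activeSet f x) (g h) := by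
  have hcg : Continuous fun ω : W => gradient (fun z => f z ω) x := by
    have h1 : Continuous fun ω : W => (x, ω) := by fun_prop
    exact hf_grad.comp_continuous h1 fun ω => ⟨hxO, mem_univ ω⟩
  have hne : (activeSet f x).Nonempty := exists_eq_maxFun hf_cont hxO
  have hcomp := isCompact_activeSet hf_cont hxO
  have hex : ∀ h : E, ∃ m, IsGreatest
      ((fun ω : W => inner ℝ (gradient (fun z => f z ω) x) h) '' activeSet f x) m := fun h =>
    (hcomp.image (hcg.inner continuous_const)).exists_isGreatest (hne.image _)
  choose g hg using hex
  obtain ⟨L, hL⟩ := hcomp.exists_bound_of_continuousOn hcg.continuousOn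
  refine ⟨g, L, ⟨fun c hc h => le_antisymm ?_ ?_, fun h k => ?_⟩, fun h => ?_, hg⟩
  · obtain ⟨ω, hω, he⟩ := (hg (c • h)).1
    rw [← he]
    simp only [inner_smul_right]
    exact mul_le_mul_of_nonneg_left ((hg h).2 ⟨ω, hω, rfl⟩) hc.le
  · obtain ⟨ω, hω, he⟩ := (hg h).1
    have h1 := (hg (c • h)).2 ⟨ω, hω, rfl⟩
    simp only [inner_smul_right] at h1
    rwa [← he]
  · obtain ⟨ω, hω, he⟩ := (hg (h + k)).1
    rw [← he]
    simp only [inner_add_right]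
    exact add_le_add ((hg h).2 ⟨ω, hω, rfl⟩) ((hg k).2 ⟨ω, hω, rfl⟩)
  · obtain ⟨ω, hω, he⟩ := (hg h).1
    rw [← he]
    exact (real_inner_le_norm _ _).trans
      (mul_le_mul_of_nonneg_right (hL ω hω) (norm_nonneg _))

/-- For `t ∈ T`, `l y ≤ l (y - t) ≤ ‖l‖ * ‖y - t‖`. This is why the norm of a multiplier serves as a
penalty parameter. -/
theorem le_norm_mul_infDist {T : Set Y} (hT : T.Nonempty) {l : StrongDual ℝ Y}
    (hl : ∀ y ∈ T, l y ≤ 0) (y : Y) : l y ≤ ‖l‖ * Metric.infDist y T := by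
  refine le_of_forall_pos_le_add fun ε hε => ?_
  have hN : 0 < ‖l‖ + 1 := by positivity
  obtain ⟨t, ht, htd⟩ := (Metric.infDist_lt_iff hT).1
    (lt_add_of_pos_right (Metric.infDist y T) (div_pos hε hN))
  rw [dist_eq_norm] at htd
  have h1 : l y = l (y - t) + l t := by rw [map_sub, sub_add_cancel]
  have h2 : l (y - t) ≤ ‖l‖ * ‖y - t‖ := (le_abs_self _).trans (l.le_opNorm _)
  have h3 := mul_le_mul_of_nonneg_left htd.le (norm_nonneg l)
  have h4 : ‖l‖ * (ε / (‖l‖ + 1)) ≤ ε := by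
    rw [mul_div_assoc', div_le_iff₀ hN]
    nlinarith
  linarith [hl t ht]

variable {A : Set E} {K : Set Y} {f : E → W → ℝ} {G : E → Y} {x : E}

/-- Lagrange multipliers correspond to nonnegativity on `T_A(x)` of the directional derivative of
some penalty function. -/
theorem exists_isLagrangeMultiplier_iff (hA : IsPointedCone (contingentCone A x))
    (hK_closed : IsClosed K) (hK_convex : Convex ℝ K)
    (hK_cone : ∀ t : ℝ, 0 < t → ∀ y ∈ K, t • y ∈ K) (hGx : G x ∈ K) {D : E →L[ℝ] Y}
    (hG : HasFDerivAt G D x) {g : E → ℝ} (hg : IsSublinear g)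
    (hF : ∀ h, HasHadamardDirDeriv (maxFun f) x h (g h)) :
    (∃ l : StrongDual ℝ Y, IsLagrangeMultiplier f G A K x l) ↔
      ∃ c ≥ (0 : ℝ), ∀ h ∈ contingentCone A x,
        0 ≤ g h + c * Metric.infDist (D h) (contingentCone K (G x)) := by
  have hTc := isPointedCone_contingentCone hK_convex hGx
  have hLag : ∀ (l : StrongDual ℝ Y) (h : E),
      HasDirDeriv (fun z => lagrangian f G z l) x h (g h + 1 * l (D h)) := fun l h => by
    have h1 := ((hF h).add_const_mul (hasHadamardDirDeriv_clm_comp hG l h) 1).hasDirDeriv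
    simp only [one_mul] at h1 ⊢
    exact h1
  have hsub : ∀ y ∈ K, y - G x ∈ contingentCone K (G x) := fun y hy => by
    simpa using sub_mem_contingentCone hK_convex hGx hy one_pos
  constructor
  · rintro ⟨l, hlK, hlG, hl⟩
    have hlT : ∀ y ∈ contingentCone K (G x), l y ≤ 0 := by
      rw [contingentCone_eq_closure hK_convex hGx]
      intro y hy
      refine closure_minimal ?_ (isClosed_le l.continuous continuous_const) hy
      rintro u ⟨t, ht, hu⟩
      have h1 := hlK _ hu
      rw [map_add, hlG, zero_add, map_smul, smul_eq_mul] at h1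
      exact nonpos_of_mul_nonpos_right h1 ht
    refine ⟨‖l‖, norm_nonneg _, fun h hh => ?_⟩
    obtain ⟨d, hd, hd0⟩ := hl h hh
    have h1 : d = g h + 1 * l (D h) := tendsto_nhds_unique hd (hLag l h)
    have h2 := le_norm_mul_infDist ⟨0, hTc.zero_mem⟩ hlT (D h)
    linarith
  · rintro ⟨c, hc, hnn⟩
    have hP : IsSublinear fun y => 0 + c * Metric.infDist y (contingentCone K (G x)) :=
      IsSublinear.add_const_mul (p := fun _ => 0) ⟨by simp, by simp⟩ (isSublinear_infDist hTc) hc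
    simp only [zero_add] at hP
    -- The bound `l ≤ c * infDist` does double duty: it makes `l` continuous, and it makes `l`
    -- nonpositive on the contingent cone of `K`.
    obtain ⟨l, hl1, hl2⟩ := exists_linear_le_of_nonneg_on_cone hA hP hg (D : E →ₗ[ℝ] Y)
      (fun v hv => by
        have := hnn v hv
        simp only [ContinuousLinearMap.coe_coe]
        linarith)
    have hbd : ∀ y, l y ≤ c * ‖y‖ := fun y => by
      refine (hl1 y).trans (mul_le_mul_of_nonneg_left ?_ hc)
      simpa using Metric.infDist_le_dist_of_mem (x := y) hTc.zero_mem
    let l' : StrongDual ℝ Y := l.mkContinuous c fun y => by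
      rw [Real.norm_eq_abs, abs_le]
      have h1 := hbd (-y)
      rw [map_neg, norm_neg] at h1
      exact ⟨by linarith, hbd y⟩
    have hlT : ∀ y ∈ contingentCone K (G x), l y ≤ 0 := fun y hy => by
      have := hl1 y
      rwa [Metric.infDist_zero_of_mem hy, mul_zero] at this
    have h0K : (0 : Y) ∈ K := by
      have h1 : Tendsto (fun t : ℝ => t • G x) (𝓝[>] 0) (𝓝 0) := by
        have h2 : Tendsto (fun t : ℝ => t • G x) (𝓝 0) (𝓝 ((0 : ℝ) • G x)) :=
          (continuous_id.smul continuous_const).tendsto 0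
        rw [zero_smul] at h2
        exact h2.mono_left nhdsWithin_le_nhds
      refine hK_closed.mem_of_tendsto h1 ?_
      filter_upwards [self_mem_nhdsWithin] with t ht
      exact hK_cone t ht _ hGx
    -- Since `K` is a cone, both `0 - G x` and `2 • G x - G x` are tangent to `K` at `G x`, so `l (G
    -- x)` has both signs.
    have hlG : l (G x) = 0 := by
      have h1 := hlT _ (hsub 0 h0K)
      have h2 := hlT _ (hsub _ (hK_cone 2 two_pos _ hGx))
      rw [two_smul, add_sub_cancel_right] at h2
      rw [zero_sub, map_neg] at h1
      linarith
    refine ⟨l', fun y hy => ?_, hlG, fun h hh => ⟨_, hLag l' h, ?_⟩⟩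
    · have h1 := hlT _ (hsub y hy)
      rw [map_sub, hlG, sub_zero] at h1
      exact h1
    · have h1 := hl2 h hh
      have h2 : l' (D h) = l (D h) := rfl
      rw [h2]
      simp only [ContinuousLinearMap.coe_coe] at h1
      linarith

end OptimalityConditions

end ConeMinimax

/-! ### Assembly of the three equivalences. -/

theorem mainTheorem2 {d : ℕ}
    {W : Type*} [TopologicalSpace W] [CompactSpace W] [T2Space W] [Nonempty W]
    {Y : Type*} [NormedAddCommGroup Y] [NormedSpace ℝ Y] [CompleteSpace Y]
    (A : Set (EuclideanSpace ℝ (Fin d))) (hA_closed : IsClosed A) (hA_convex : Convex ℝ A)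
    (K : Set Y) (hK_nonempty : K.Nonempty) (hK_closed : IsClosed K) (hK_convex : Convex ℝ K)
    (hK_cone : ∀ t : ℝ, 0 < t → ∀ y ∈ K, t • y ∈ K)
    (f : EuclideanSpace ℝ (Fin d) → W → ℝ) (G : EuclideanSpace ℝ (Fin d) → Y)
    (x : EuclideanSpace ℝ (Fin d)) (hx : x ∈ feasibleSet G A K)
    (O : Set (EuclideanSpace ℝ (Fin d))) (hO : IsOpen O) (hxO : x ∈ O)
    (hf_cont : ContinuousOn
      (fun p : EuclideanSpace ℝ (Fin d) × W => f p.1 p.2) (O ×ˢ univ))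
    (hf_diff : ∀ z ∈ O, ∀ ω : W, DifferentiableAt ℝ (fun z => f z ω) z)
    (hf_grad : ContinuousOn
      (fun p : EuclideanSpace ℝ (Fin d) × W => gradient (fun z => f z p.2) p.1) (O ×ˢ univ))
    (hG : ContDiffOn ℝ 1 G O) :
    ((∃ l : StrongDual ℝ Y, IsLagrangeMultiplier f G A K x l) ↔
      ∃ c ≥ (0 : ℝ), (0 : EuclideanSpace ℝ (Fin d)) ∈
        hadamardSubdifferential (penaltyFun f G K c) x + normalCone A x) ∧
    ((SuffOptCond f G A K x ↔
        ∃ c ≥ (0 : ℝ), (0 : EuclideanSpace ℝ (Fin d)) ∈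
          interior (hadamardSubdifferential (penaltyFun f G K c) x + normalCone A x)) ∧
      (SuffOptCond f G A K x ↔
        ∃ c ≥ (0 : ℝ), FirstOrderGrowth (penaltyFun f G K c) A x)) ∧
    (RCQ G A K x →
      (IsLocallyOptimal f G A K x → PenaltyLocallyExact f G A K x) ∧
      (FirstOrderGrowth (maxFun f) (feasibleSet G A K) x ↔
        ∃ c ≥ (0 : ℝ), FirstOrderGrowth (penaltyFun f G K c) A x)) := by
  obtain ⟨hxA, hxK⟩ := hx
  have hxK : G x ∈ K := hxK
  have hOx : O ∈ 𝓝 x := hO.mem_nhds hxO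
  have hGs : HasStrictFDerivAt G (fderiv ℝ G x) x :=
    (hG.contDiffAt hOx).hasStrictFDerivAt one_ne_zero
  have hGd := hGs.hasFDerivAt
  set T := contingentCone A x with hT
  have hTc : IsPointedCone T := isPointedCone_contingentCone hA_convex hxA
  have hTcl : IsClosed T := isClosed_contingentCone hA_convex hxA
  have hTKc := isPointedCone_contingentCone hK_convex hxK
  have hTKcl := isClosed_contingentCone hK_convex hxK
  set p : EuclideanSpace ℝ (Fin d) → ℝ :=
    fun h => Metric.infDist (fderiv ℝ G x h) (contingentCone K (G x)) with hp
  have hps : IsSublinear p :=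
    (isSublinear_infDist hTKc).comp_linear (fderiv ℝ G x : EuclideanSpace ℝ (Fin d) →ₗ[ℝ] Y)
  have hpM : ∀ h, p h ≤ ‖fderiv ℝ G x‖ * ‖h‖ := fun h =>
    (Metric.infDist_le_dist_of_mem hTKc.zero_mem).trans
      (by rw [dist_zero_right]; exact (fderiv ℝ G x).le_opNorm h)
  obtain ⟨g, L, hgs, hgL, hg⟩ := exists_sublinear_isGreatest_gradient hxO hf_cont hf_grad
  have hF : ∀ h, HasHadamardDirDeriv (maxFun f) x h (g h) := fun h =>
    hasHadamardDirDeriv_maxFun hO hxO hf_cont hf_diff hf_grad (hg h)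
  have hΦ : ∀ c h, HasHadamardDirDeriv (penaltyFun f G K c) x h (g h + c * p h) := fun c h =>
    (hF h).add_const_mul (hasHadamardDirDeriv_infDist_comp hGd hK_convex hxK h) c
  have hqs : ∀ c : ℝ, 0 ≤ c → IsSublinear fun h => g h + c * p h := fun c hc =>
    hgs.add_const_mul hps hc
  have hqM : ∀ c : ℝ, 0 ≤ c → ∀ h, g h + c * p h ≤ (L + c * ‖fderiv ℝ G x‖) * ‖h‖ :=
    fun c hc h => by
      have := mul_le_mul_of_nonneg_left (hpM h) hc
      linarith [hgL h]
  have hsubd : ∀ c : ℝ, 0 ≤ c → hadamardSubdifferential (penaltyFun f G K c) x =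
      {w | ∀ v, inner ℝ w v ≤ g v + c * p v} := fun c hc =>
    hadamardSubdifferential_eq ((hqs c hc).isHadamardSubdifferential (hqM c hc) (hΦ c))
  -- The contingent cone of `K` is closed, so the linearised constraint is exactly `p h = 0` and can
  -- be penalised.
  have hsuff : SuffOptCond f G A K x ↔ ∃ c ≥ (0 : ℝ), ∃ ρ > 0, ∀ h ∈ T, ρ * ‖h‖ ≤ g h + c * p h := by
    calc SuffOptCond f G A K x ↔ ∀ h ∈ T, h ≠ 0 → p h = 0 → 0 < g h := by
          refine forall₃_congr fun h _ _ => imp_congr ?_ ?_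
          · exact hTKcl.mem_iff_infDist_zero ⟨0, hTKc.zero_mem⟩
          · exact ⟨fun ⟨m, hm, hm0⟩ => (hg h).unique hm ▸ hm0, fun h0 => ⟨_, hg h, h0⟩⟩
      _ ↔ ∃ c ≥ (0 : ℝ), ∀ h ∈ T, h ≠ 0 → 0 < g h + c * p h :=
          forall_pos_of_eq_zero_iff_exists_penalty hgs hps hgL hpM
            (fun _ => Metric.infDist_nonneg) hTc hTcl
      _ ↔ _ := exists_congr fun c => and_congr_right fun hc =>
          (hqs c hc).forall_pos_iff (hqM c hc) hTc hTcl
  refine ⟨?_, ⟨?_, ?_⟩, fun hR => ?_⟩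
  · rw [exists_isLagrangeMultiplier_iff hTc hK_closed hK_convex hK_cone hxK hGd hgs hF]
    refine exists_congr fun c => and_congr_right fun hc => ?_
    rw [hsubd c hc, (hqs c hc).zero_mem_add_normalCone_iff hTc]
  · rw [hsuff]
    refine exists_congr fun c => and_congr_right fun hc => ?_
    rw [hsubd c hc, (hqs c hc).zero_mem_interior_add_normalCone_iff hTc]
  · rw [hsuff]
    exact exists_congr fun c => and_congr_right fun hc => (firstOrderGrowth_iff (hΦ c)).symm
  · obtain ⟨κ, hκ, herr⟩ := exists_error_bound hA_closed hA_convex hK_closed hK_convex hxA hxK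
      hOx hG.continuousOn hGs hR
    obtain ⟨L', hL', r, hr, hLip⟩ := exists_lipschitz_maxFun hO hxO hf_cont hf_diff hf_grad
    have hpen : ∀ c, penaltyFun f G K c x = maxFun f x := fun c => by
      rw [penaltyFun, Metric.infDist_zero_of_mem hxK, mul_zero, add_zero]
    -- Local optimality is the case `ρ = 0` of the growth transfer.
    refine ⟨fun hopt => ⟨(L' + 0) / κ, by positivity, fun c hc => ?_⟩, fun hgr => ?_, ?_⟩
    · have hloc := hopt.2
      rw [IsLocalMinOn, IsMinFilter, eventually_nhdsWithin_iff] at hloc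
      have h1 := eventually_penalty_growth hκ hL' le_rfl hr herr hxK hGd.continuousAt hLip hloc
        (fun z hz hzA hzK => by simpa using hz ⟨hzA, hzK⟩) hc
      rw [IsLocalMinOn, IsMinFilter, eventually_nhdsWithin_iff]
      filter_upwards [h1] with z hz hzA
      have h2 := hz hzA
      rw [zero_mul, add_zero] at h2
      rw [hpen]
      exact h2
    · obtain ⟨ρ, hρ, U, hU, hgrow⟩ := hgr
      have h1 := eventually_penalty_growth hκ hL' hρ.le hr herr hxK hGd.continuousAt hLip hU
        (fun z hz hzA hzK => hgrow z ⟨hz, hzA, hzK⟩) le_rfl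
      refine ⟨(L' + ρ) / κ, by positivity, ρ, hρ, _, h1, fun z hz => ?_⟩
      rw [hpen]
      exact hz.1 hz.2
    · rintro ⟨c, hc, ρ, hρ, U, hU, hgrow⟩
      refine ⟨ρ, hρ, U, hU, fun z hz => ?_⟩
      have h1 := hgrow z ⟨hz.1, hz.2.1⟩
      have h2 : penaltyFun f G K c z = maxFun f z := by
        rw [penaltyFun, Metric.infDist_zero_of_mem hz.2.2, mul_zero, add_zero]
      rwa [hpen, h2] at h1
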